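/- Let $V=V(x,\xi)\in C^\infty(\mathbb{R}^2)$ be a complex-valued function which is $1$-periodic in $\xi$ and such that for some bounded segment $[x_0,x_1]$ the inclusion $\operatorname{supp}V(\cdot,\xi)\subseteq[x_0,x_1]$ holds for all $\xi\in\mathbb{R}$. Suppose that $\int_0^1 V(x,\xi)\,d\xi=0$ for all $x\in\mathbb{R}$. For $\varepsilon>0$ let $$H_\varepsilon=-\frac{d^2}{dx^2}+V\Big(x,\frac{x}{\varepsilon}\Big)$$ be the operator in $L_2(\mathbb{R})$ with domain the Sobolev space $W_2^2(\mathbb{R})$, and set $$P[V](x,\xi)=\int_0^\xi V(x,\tau)\,d\tau+\int_0^1\tau V(x,\tau)\,d\tau,\qquad k_2=\frac12\int_{\mathbb{R}}\int_0^1\big(P[V](x,\xi)\big)^2\,d\xi\,dx .$$ 1. If $\operatorname{Re}k_2>0$, then $H_\varepsilon$ has a unique eigenvalue $\lambda_\varepsilon$ tending to zero as $\varepsilon\to+0$: for all sufficiently small $\varepsilon>0$ there is an eigenvalue $\lambda_\varepsilon$ of $H_\varepsilon$ such that $\lambda_\varepsilon\to0$ as $\varepsilon\to+0$, and there is $\delta>0$,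 independent of $\varepsilon$, such that for all sufficiently small $\varepsilon>0$ the operator $H_\varepsilon$ has no eigenvalue other than $\lambda_\varepsilon$ in the disk $\{\lambda\in\mathbb{C}:|\lambda|<\delta\}$. For all sufficiently small $\varepsilon>0$ the eigenvalue $\lambda_\varepsilon$ is simple (it has algebraic multiplicity one), and $$\lambda_\varepsilon=-\varepsilon^4k_2^2+\mathcal{O}(\varepsilon^5),\qquad \varepsilon\to+0 .$$ 2. If $\operatorname{Re}k_2<0$, then $H_\varepsilon$ has no eigenvalues tending to zero as $\varepsilon\to+0$: there is $\delta>0$ such that for all sufficiently small $\varepsilon>0$ the operator $H_\varepsilon$ has no eigenvalues in the disk $\{\lambda\in\mathbb{C}:|\lambda|<\delta\}$. -/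

import Mathlib

open MeasureTheory Filter Topology Asymptotics
open scoped ContDiff

noncomputable section

/-- The Hilbert space `L₂(ℝ)` of complex-valued functions. -/
abbrev L2R : Type := Lp ℂ 2 (volume : Measure ℝ)

/-! ### The Sobolev space `W₂²(ℝ)` and the operator `-d²/dx²` -/

/-- `g ∈ L₂(ℝ)` is the weak (distributional) derivative of `f ∈ L₂(ℝ)`. -/
def HasWeakDeriv (f g : L2R) : Prop :=
  ∀ φ : ℝ → ℝ, ContDiff ℝ ∞ φ → HasCompactSupport φ →
    ∫ x, deriv φ x • f x = -∫ x, φ x • g x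

theorem L2R.integrable_smul (f : L2R) {φ : ℝ → ℝ} (hφ : Continuous φ)
    (hc : HasCompactSupport φ) : Integrable (fun x => φ x • f x) :=
  ((Lp.memLp f).locallyIntegrable (by norm_num)).integrable_smul_left_of_hasCompactSupport hφ hc

theorem HasWeakDeriv.unique {f g h : L2R} (hg : HasWeakDeriv f g) (hh : HasWeakDeriv f h) :
    g = h := by
  apply Lp.ext
  refine ae_eq_of_integral_contDiff_smul_eq ((Lp.memLp g).locallyIntegrable (by norm_num))
    ((Lp.memLp h).locallyIntegrable (by norm_num)) fun φ hφ hc => ?_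
  have h1 := hg φ hφ hc
  have h2 := hh φ hφ hc
  rw [h1] at h2
  exact neg_injective h2

theorem HasWeakDeriv.zero : HasWeakDeriv 0 0 := by
  intro φ _ _
  have h0 : ((0 : L2R) : ℝ → ℂ) =ᵐ[volume] 0 := Lp.coeFn_zero ℂ 2 volume
  have h1 : ∀ ψ : ℝ → ℝ, ∫ x, ψ x • (0 : L2R) x = 0 := fun ψ => by
    rw [integral_congr_ae (g := fun _ => (0 : ℂ))]
    · simp
    · filter_upwards [h0] with x _
      simp
  rw [h1, h1, neg_zero]

theorem HasWeakDeriv.add {f g f' g' : L2R} (hf : HasWeakDeriv f f') (hg : HasWeakDeriv g g') :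
    HasWeakDeriv (f + g) (f' + g') := by
  intro φ hφ hc
  have key : ∀ (ψ : ℝ → ℝ), Continuous ψ → HasCompactSupport ψ → ∀ a b : L2R,
      ∫ x, ψ x • (a + b : L2R) x = (∫ x, ψ x • a x) + ∫ x, ψ x • b x := by
    intro ψ h1 h2 a b
    rw [← integral_add (a.integrable_smul h1 h2) (b.integrable_smul h1 h2)]
    apply integral_congr_ae
    filter_upwards [Lp.coeFn_add a b] with x hx
    rw [hx, Pi.add_apply, smul_add]
  rw [key _ (hφ.continuous_deriv (by simp)) hc.deriv, key _ hφ.continuous hc,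
    hf φ hφ hc, hg φ hφ hc]
  ring

theorem HasWeakDeriv.smul (c : ℂ) {f f' : L2R} (hf : HasWeakDeriv f f') :
    HasWeakDeriv (c • f) (c • f') := by
  intro φ hφ hc
  have key : ∀ (ψ : ℝ → ℝ) (a : L2R),
      ∫ x, ψ x • (c • a : L2R) x = c * ∫ x, ψ x • a x := by
    intro ψ a
    rw [← integral_const_mul]
    apply integral_congr_ae
    filter_upwards [Lp.coeFn_smul c a] with x hx
    simp only [hx, Pi.smul_apply, smul_eq_mul, Complex.real_smul]
    ring
  rw [key, key, hf φ hφ hc]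
  ring

/-- The Sobolev space `W₂²(ℝ)`: functions in `L₂(ℝ)` whose weak derivatives of orders one and two
exist and belong to `L₂(ℝ)`. -/
def sobolevW22 : Submodule ℂ L2R where
  carrier := {u | ∃ u' u'', HasWeakDeriv u u' ∧ HasWeakDeriv u' u''}
  zero_mem' := ⟨0, 0, .zero, .zero⟩
  add_mem' := by
    rintro u v ⟨u', u'', h1, h2⟩ ⟨v', v'', h3, h4⟩
    exact ⟨_, _, h1.add h3, h2.add h4⟩
  smul_mem' := by
    rintro c u ⟨u', u'', h1, h2⟩
    exact ⟨_, _, h1.smul c, h2.smul c⟩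

/-- The second weak derivative of a function in `W₂²(ℝ)`. -/
def weakSecondDeriv (u : sobolevW22) : L2R := u.2.choose_spec.choose

theorem weakSecondDeriv_spec (u : sobolevW22) :
    ∃ u', HasWeakDeriv u u' ∧ HasWeakDeriv u' (weakSecondDeriv u) :=
  ⟨u.2.choose, u.2.choose_spec.choose_spec⟩

theorem weakSecondDeriv_eq {u : sobolevW22} {u' u'' : L2R} (h1 : HasWeakDeriv u u')
    (h2 : HasWeakDeriv u' u'') : weakSecondDeriv u = u'' := by
  obtain ⟨w, h3, h4⟩ := weakSecondDeriv_spec u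
  obtain rfl := h1.unique h3
  exact h4.unique h2

/-- The operator `-d²/dx²` on `W₂²(ℝ)`. -/
def negSecondDeriv : sobolevW22 →ₗ[ℂ] L2R where
  toFun u := -weakSecondDeriv u
  map_add' u v := by
    obtain ⟨_, h1, h2⟩ := weakSecondDeriv_spec u
    obtain ⟨_, h3, h4⟩ := weakSecondDeriv_spec v
    rw [weakSecondDeriv_eq (u := u + v) (h1.add h3) (h2.add h4), neg_add]
  map_smul' c u := by
    obtain ⟨_, h1, h2⟩ := weakSecondDeriv_spec u
    rw [weakSecondDeriv_eq (u := c • u) (h1.smul c) (h2.smul c), RingHom.id_apply, smul_neg]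

/-! ### The potential and the perturbed operator -/

/-- `V = V(x, ξ)` is an infinitely differentiable complex-valued function on `ℝ²`, `1`-periodic
in `ξ`, and the supports of `V(·, ξ)` are bounded uniformly in `ξ`. -/
structure IsOscillatingPotential (V : ℝ → ℝ → ℂ) : Prop where
  smooth : ContDiff ℝ ∞ (fun p : ℝ × ℝ => V p.1 p.2)
  periodic : ∀ x ξ, V x (ξ + 1) = V x ξ
  support : ∃ x₀ x₁ : ℝ, ∀ ξ, tsupport (fun x => V x ξ) ⊆ Set.Icc x₀ x₁

/-- The function `x ↦ V(x, x/ε)` is (essentially) bounded. -/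
theorem IsOscillatingPotential.memLp_top {V : ℝ → ℝ → ℂ} (hV : IsOscillatingPotential V) (ε : ℝ) :
    MemLp (fun x => V x (x / ε)) ⊤ (volume : Measure ℝ) := by
  have hcont : Continuous fun x => V x (x / ε) :=
    hV.smooth.continuous.comp (continuous_id.prodMk (continuous_id.div_const ε))
  obtain ⟨x₀, x₁, hs⟩ := hV.support
  refine hcont.memLp_top_of_hasCompactSupport ?_ _
  refine HasCompactSupport.intro (isCompact_Icc (a := x₀) (b := x₁)) fun x hx => ?_
  exact image_eq_zero_of_notMem_tsupport (f := fun y => V y (x / ε)) fun h => hx (hs _ h)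

/-- Multiplication by a (essentially) bounded function `q`, as an operator on `L₂(ℝ)`. -/
def mulOp {q : ℝ → ℂ} (hq : MemLp q ⊤ (volume : Measure ℝ)) : L2R →ₗ[ℂ] L2R where
  toFun u := hq.toLp q • u
  map_add' u v := Lp.add_smul (hq.toLp q) u v
  map_smul' c u := by
    apply Lp.ext
    filter_upwards [Lp.coeFn_lpSMul (r := 2) (hq.toLp q) (c • u), Lp.coeFn_smul c u,
      Lp.coeFn_smul c (hq.toLp q • u : L2R),
      Lp.coeFn_lpSMul (r := 2) (hq.toLp q) u] with x h1 h2 h3 h4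
    simp only [RingHom.id_apply]
    rw [h1, h3, Pi.smul_apply', h2, Pi.smul_apply, Pi.smul_apply, h4, Pi.smul_apply',
      smul_comm]

/-- The operator `H_ε = -d²/dx² + V(x, x/ε)` in `L₂(ℝ)` with domain `W₂²(ℝ)`. -/
def schrodingerOp {V : ℝ → ℝ → ℂ} (hV : IsOscillatingPotential V) (ε : ℝ) : L2R →ₗ.[ℂ] L2R where
  domain := sobolevW22
  toFun := negSecondDeriv + mulOp (hV.memLp_top ε) ∘ₗ sobolevW22.subtype

/-- The primitive in `ξ`:
`P[u](x, ξ) = ∫₀^ξ u(x, τ) dτ + ∫₀¹ τ u(x, τ) dτ`. -/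
def fastPrimitive (u : ℝ → ℝ → ℂ) (x ξ : ℝ) : ℂ :=
  (∫ τ in (0 : ℝ)..ξ, u x τ) + ∫ τ in (0 : ℝ)..1, (τ : ℂ) * u x τ

/-- `k₂ = ½ ∫_ℝ ⟨P[V](x, ·)²⟩ dx`, where `⟨·⟩` is the mean value over the period `[0, 1]`. -/
def kTwo (V : ℝ → ℝ → ℂ) : ℂ :=
  (1 / 2 : ℂ) * ∫ x : ℝ, ∫ ξ in (0 : ℝ)..1, fastPrimitive V x ξ ^ 2

/-! ### Eigenvalues of unbounded operators -/

section Eigenvalues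

variable {E : Type*} [AddCommGroup E] [Module ℂ E]

/-- `μ` is an eigenvalue of the operator `T`. -/
def IsEigenvalue (T : E →ₗ.[ℂ] E) (μ : ℂ) : Prop :=
  ∃ u : T.domain, u ≠ 0 ∧ T u = μ • (u : E)

/-- The kernel of `(T - μ)ⁿ`, where `(T - μ)ⁿ` has its natural domain. -/
def powKer (T : E →ₗ.[ℂ] E) (μ : ℂ) : ℕ → Submodule ℂ E
  | 0 => ⊥
  | n + 1 =>
    { carrier := {u | ∃ h : u ∈ T.domain, T ⟨u, h⟩ - μ • u ∈ powKer T μ n}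
      zero_mem' := ⟨T.domain.zero_mem, by
        have h : T ⟨0, T.domain.zero_mem⟩ = 0 := T.map_zero
        rw [h, smul_zero, sub_zero]
        exact Submodule.zero_mem _⟩
      add_mem' := by
        rintro u v ⟨hu, hu'⟩ ⟨hv, hv'⟩
        refine ⟨T.domain.add_mem hu hv, ?_⟩
        have h : T ⟨u + v, T.domain.add_mem hu hv⟩ = T ⟨u, hu⟩ + T ⟨v, hv⟩ :=
          T.map_add ⟨u, hu⟩ ⟨v, hv⟩
        rw [h, smul_add, add_sub_add_comm]
        exact Submodule.add_mem _ hu' hv'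
      smul_mem' := by
        rintro c u ⟨hu, hu'⟩
        refine ⟨T.domain.smul_mem c hu, ?_⟩
        have h : T ⟨c • u, T.domain.smul_mem c hu⟩ = c • T ⟨u, hu⟩ :=
          T.map_smul c ⟨u, hu⟩
        rw [h, smul_comm μ c, ← smul_sub]
        exact Submodule.smul_mem _ c hu' }

/-- The root subspace `⋃ₙ ker (T - μ)ⁿ` of eigenvectors and associated vectors (the union is
increasing, so it is the supremum). -/
def rootSubspace (T : E →ₗ.[ℂ] E) (μ : ℂ) : Submodule ℂ E := ⨆ n, powKer T μ n

/-- `μ` is a simple eigenvalue of `T`: an eigenvalue of algebraic multiplicity one. -/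
def IsSimpleEigenvalue (T : E →ₗ.[ℂ] E) (μ : ℂ) : Prop :=
  IsEigenvalue T μ ∧ Module.rank ℂ (rootSubspace T μ) = 1

end Eigenvalues

end

/-!
For `q(x) = V(x, x/ε)`, supported in `[a, b]`, let `u(·, k)` be the solution of `u'' = (q + k²) u`
that equals `e^{k(x - a)}` for `x ≤ a` (`IsLeftSolution`), and put `D(k) = u'(b) + k u(b)`. When
`0 ≤ Re k`, every square integrable solution is a multiple of `u`, and `u` is square integrable
exactly when `0 < Re k` and `D(k) = 0`. Hence the eigenvalues of `H_ε` are the numbers `-k²` with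
`0 < Re k` and `D(k) = 0` (`boundary_eq_zero_of_isEigenvalue`, `isSimpleEigenvalue_of_boundary_eq_zero`). The
passage between `L₂` functions with weak derivatives and classical solutions is the lemma of du
Bois-Reymond (`HasWeakDeriv.exists_classical`, `hasWeakDeriv_of_hasDerivAt`).

The zeros of `D` near `0` are found by replacing `q` by its primitive `Q(x) = ∫_a^x q`. With the
quasi-derivative `v = u' - Q u` the equation becomes `u' = Q u + v`, `v' = (k² - Q²) u - Q v`.
Because `V` has zero mean in the fast variable, integration by parts in the fast variable gives
`Q = O(ε)`, `Q(b) = O(ε³)` and `∫ Q² = 2 k₂ ε² + O(ε³)`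
(`IsOscillatingPotential.exists_primitive_bounds`). Gronwall's inequality then yields
`D(0) = -2 k₂ ε² + O(ε³)` and `D(k) - D(l) = 2 (k - l) + O((ε + |k| + |l|) |k - l|)`
(`IsLeftSolution.norm_boundary_zero_le`, `IsLeftSolution.norm_boundary_sub_le`), so
`k ↦ k - D(k)/2` is a contraction of a fixed small disk: `D` has exactly one zero there, and it is
`k₂ ε² + O(ε³)`. The sign of `Re k₂` decides whether it lies in the half-plane `0 < Re k`.

The eigenvalue is simple because `(H_ε - λ) w = c u` forces `c ∫ u² = 0` (the Wronskian of `w` and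
`u` is integrable, `mul_integral_sq_eq_zero`), whereas the exponential tails make `∫ u²` close to
`1/k`, hence nonzero (`IsLeftSolution.integral_sq_ne_zero`).
-/

/-! ### Linear differential equations on the line -/

theorem abs_integral_exp_mul_abs_sub_le {M : ℝ} (hM : 0 < M) (a x : ℝ) :
    |∫ t in a..x, Real.exp (M * |t - a|)| ≤ Real.exp (M * |x - a|) / M := by
  rcases le_total a x with h | h
  · have h1 : ∫ t in a..x, Real.exp (M * |t - a|) = ∫ t in a..x, Real.exp (M * (t - a)) := by
      refine intervalIntegral.integral_congr fun t ht => ?_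
      rw [Set.uIcc_of_le h] at ht
      simp only [abs_of_nonneg (sub_nonneg.2 ht.1)]
    have h2 : ∫ t in a..x, Real.exp (M * (t - a)) =
        Real.exp (M * (x - a)) / M - Real.exp (M * (a - a)) / M := by
      refine intervalIntegral.integral_eq_sub_of_hasDerivAt
        (f := fun t => Real.exp (M * (t - a)) / M) (fun t _ => ?_)
        (by apply Continuous.intervalIntegrable; fun_prop)
      have := ((((hasDerivAt_id t).sub_const a).const_mul M).exp).div_const M
      exact this.congr_deriv (by simp [hM.ne'])
    rw [h1, h2, abs_of_nonneg (sub_nonneg.2 h), abs_of_nonneg]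
    · have : 0 ≤ Real.exp (M * (a - a)) / M := by positivity
      linarith
    · rw [sub_nonneg]; gcongr
  · have h1 : ∫ t in a..x, Real.exp (M * |t - a|) = ∫ t in a..x, Real.exp (M * (a - t)) := by
      refine intervalIntegral.integral_congr fun t ht => ?_
      rw [Set.uIcc_of_ge h] at ht
      simp only [abs_of_nonpos (sub_nonpos.2 ht.2), neg_sub]
    have h2 : ∫ t in a..x, Real.exp (M * (a - t)) =
        -Real.exp (M * (a - x)) / M - -Real.exp (M * (a - a)) / M := by
      refine intervalIntegral.integral_eq_sub_of_hasDerivAt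
        (f := fun t => -Real.exp (M * (a - t)) / M) (fun t _ => ?_)
        (by apply Continuous.intervalIntegrable; fun_prop)
      have := ((((hasDerivAt_id t).const_sub a).const_mul M).exp).neg.div_const M
      exact this.congr_deriv (by simp [hM.ne'])
    rw [h1, h2, abs_of_nonpos (sub_nonpos.2 h), neg_sub, abs_of_nonpos]
    · have : 0 ≤ Real.exp (M * (a - a)) / M := by positivity
      rw [neg_div, neg_div]
      linarith
    · rw [sub_nonpos]; gcongr

/-- A linear differential equation with bounded continuous coefficients has a global solution.
The Picard map is a contraction for the norm `sup_x e^{-M|x - a|} ‖y x‖` when `M` exceeds the bound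
of the coefficients; the proof works with `z = e^{-M|x - a|} y`. -/
theorem exists_hasDerivAt_linear {E : Type*} [NormedAddCommGroup E] [NormedSpace ℝ E]
    [CompleteSpace E] {A : ℝ → E →L[ℝ] E} (hA : Continuous A) {K : ℝ} (hK : ∀ x, ‖A x‖ ≤ K)
    (a : ℝ) (y₀ : E) :
    ∃ y : ℝ → E, y a = y₀ ∧ ∀ x, HasDerivAt y (A x (y x)) x := by
  have hK0 : 0 ≤ K := (norm_nonneg _).trans (hK 0)
  set M : ℝ := 2 * K + 1 with hMdef
  have hM : 0 < M := by positivity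
  let w : ℝ → ℝ := fun x => Real.exp (M * |x - a|)
  have hw : Continuous w := by fun_prop
  have hwpos : ∀ x, 0 < w x := fun x => Real.exp_pos _
  have hw1 : ∀ x, 1 ≤ w x := fun x => Real.one_le_exp (by positivity)
  have hcont : ∀ z : ℝ → E, Continuous z → Continuous fun t => A t (w t • z t) := fun z hz =>
    hA.clm_apply (hw.smul hz)
  have hint : ∀ z : BoundedContinuousFunction ℝ E, ∀ x,
      ‖∫ t in a..x, A t (w t • z t)‖ ≤ K * ‖z‖ * (w x / M) := by
    intro z x
    have h1 : ‖∫ t in a..x, A t (w t • z t)‖ ≤ |∫ t in a..x, K * ‖z‖ * w t| := by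
      refine intervalIntegral.norm_integral_le_abs_of_norm_le ?_
        (by apply Continuous.intervalIntegrable; fun_prop)
      refine Filter.Eventually.of_forall fun t => ?_
      calc ‖A t (w t • z t)‖ ≤ ‖A t‖ * ‖w t • z t‖ := (A t).le_opNorm _
        _ ≤ K * (w t * ‖z‖) := by
          rw [norm_smul, Real.norm_of_nonneg (hwpos t).le]
          gcongr
          · exact hK t
          · exact z.norm_coe_le_norm t
        _ = K * ‖z‖ * w t := by ring
    refine h1.trans ?_
    rw [intervalIntegral.integral_const_mul, abs_mul, abs_of_nonneg (by positivity)]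
    gcongr
    exact abs_integral_exp_mul_abs_sub_le hM a x
  have hTcont : ∀ z : BoundedContinuousFunction ℝ E,
      Continuous fun x => (w x)⁻¹ • (y₀ + ∫ t in a..x, A t (w t • z t)) := fun z => by
    have h2 : Continuous fun x => ∫ t in a..x, A t (w t • z t) :=
      intervalIntegral.continuous_primitive
        (fun _ _ => (hcont z z.continuous).intervalIntegrable _ _) a
    exact (hw.inv₀ fun x => (hwpos x).ne').smul (continuous_const.add h2)
  have hTbdd : ∀ z : BoundedContinuousFunction ℝ E, ∀ x,
      ‖(w x)⁻¹ • (y₀ + ∫ t in a..x, A t (w t • z t))‖ ≤ ‖y₀‖ + K * ‖z‖ / M := fun z x => by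
    rw [norm_smul, norm_inv, Real.norm_of_nonneg (hwpos x).le, inv_mul_le_iff₀ (hwpos x)]
    refine (norm_add_le _ _).trans ?_
    have h3 := hint z x
    have h4 : ‖y₀‖ ≤ w x * ‖y₀‖ := le_mul_of_one_le_left (norm_nonneg _) (hw1 x)
    calc ‖y₀‖ + _ ≤ w x * ‖y₀‖ + K * ‖z‖ * (w x / M) := add_le_add h4 h3
      _ = _ := by ring
  let T : BoundedContinuousFunction ℝ E → BoundedContinuousFunction ℝ E := fun z =>
    BoundedContinuousFunction.ofNormedAddCommGroup _ (hTcont z) _ (hTbdd z)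
  have hT : ∀ z x, T z x = (w x)⁻¹ • (y₀ + ∫ t in a..x, A t (w t • z t)) := fun _ _ => rfl
  have hcontr : ContractingWith (1 / 2) T := by
    refine ⟨by norm_num, LipschitzWith.of_dist_le_mul fun z z' => ?_⟩
    rw [BoundedContinuousFunction.dist_le (by positivity)]
    intro x
    rw [hT, hT, dist_eq_norm, ← smul_sub, add_sub_add_left_eq_sub,
      ← intervalIntegral.integral_sub ((hcont z z.continuous).intervalIntegrable _ _)
        ((hcont z' z'.continuous).intervalIntegrable _ _)]
    have h5 : ∀ t, A t (w t • z t) - A t (w t • z' t) = A t (w t • (z - z') t) := fun t => by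
      rw [← map_sub, ← smul_sub]; rfl
    simp_rw [h5]
    rw [norm_smul, norm_inv, Real.norm_of_nonneg (hwpos x).le, inv_mul_le_iff₀ (hwpos x)]
    refine (hint (z - z') x).trans ?_
    rw [dist_eq_norm]
    have h6 : K / M ≤ 1 / 2 := by
      rw [div_le_div_iff₀ hM two_pos, hMdef]; linarith
    calc K * ‖z - z'‖ * (w x / M) = (K / M) * (w x * ‖z - z'‖) := by ring
      _ ≤ 1 / 2 * (w x * ‖z - z'‖) := by
        gcongr
      _ = _ := by push_cast; ring
  obtain ⟨z, hz⟩ : ∃ z, T z = z := ⟨_, hcontr.fixedPoint_isFixedPt⟩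
  have hy : ∀ x, w x • z x = y₀ + ∫ t in a..x, A t (w t • z t) := fun x => by
    conv_lhs => rw [← hz, hT, smul_smul, mul_inv_cancel₀ (hwpos x).ne', one_smul]
  refine ⟨fun x => w x • z x, by simp [hy a], fun x => ?_⟩
  have h7 := ((hcont z z.continuous).integral_hasStrictDerivAt a x).hasDerivAt.const_add y₀
  exact h7.congr_of_eventuallyEq (Filter.Eventually.of_forall hy)

/-- The equation `u'' = p u` with a bounded continuous coefficient has a solution on the whole line
for all Cauchy data. -/
theorem exists_hasDerivAt_second_order {p : ℝ → ℂ} (hp : Continuous p) {K : ℝ}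
    (hK : ∀ x, ‖p x‖ ≤ K) (a : ℝ) (c d : ℂ) :
    ∃ u u' : ℝ → ℂ, u a = c ∧ u' a = d ∧ (∀ x, HasDerivAt u (u' x) x) ∧
      ∀ x, HasDerivAt u' (p x * u x) x := by
  let S : ℂ × ℂ →L[ℝ] ℂ × ℂ :=
    (ContinuousLinearMap.snd ℝ ℂ ℂ).prod 0
  let R : ℂ →L[ℝ] (ℂ × ℂ →L[ℝ] ℂ × ℂ) :=
    (ContinuousLinearMap.compL ℝ (ℂ × ℂ) ℂ (ℂ × ℂ) (ContinuousLinearMap.inr ℝ ℂ ℂ)).comp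
      (((ContinuousLinearMap.compL ℝ (ℂ × ℂ) ℂ ℂ).flip (ContinuousLinearMap.fst ℝ ℂ ℂ)).comp
        (ContinuousLinearMap.mul ℝ ℂ))
  have hA : Continuous fun x => S + R (p x) := continuous_const.add (R.continuous.comp hp)
  obtain ⟨y, hy0, hy⟩ := exists_hasDerivAt_linear hA (K := ‖S‖ + ‖R‖ * K)
    (fun x => (norm_add_le _ _).trans (add_le_add le_rfl
      ((R.le_opNorm _).trans (mul_le_mul_of_nonneg_left (hK x) (norm_nonneg _))))) a (c, d)
  refine ⟨fun x => (y x).1, fun x => (y x).2, by simp [hy0], by simp [hy0], fun x => ?_,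
    fun x => ?_⟩
  · have := (ContinuousLinearMap.fst ℝ ℂ ℂ).hasFDerivAt.comp_hasDerivAt x (hy x)
    simpa [S, R, Function.comp_def] using this
  · have := (ContinuousLinearMap.snd ℝ ℂ ℂ).hasFDerivAt.comp_hasDerivAt x (hy x)
    simpa [S, R, Function.comp_def] using this

/-- A solution of `u'' = p u` with zero Cauchy data vanishes. -/
theorem eq_zero_of_second_order {p : ℝ → ℂ} {K : ℝ} (hK : ∀ x, ‖p x‖ ≤ K) {u u' : ℝ → ℂ}
    (hu : ∀ x, HasDerivAt u (u' x) x) (hu' : ∀ x, HasDerivAt u' (p x * u x) x) {a : ℝ}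
    (h0 : u a = 0) (h0' : u' a = 0) : u = 0 := by
  have hK0 : 0 ≤ K := (norm_nonneg _).trans (hK 0)
  have hl : ∀ t, LipschitzOnWith (Real.toNNReal (K + 1))
      (fun y : ℂ × ℂ => ((y.2, p t * y.1) : ℂ × ℂ)) Set.univ := fun t => by
    refine LipschitzWith.lipschitzOnWith (LipschitzWith.of_dist_le_mul fun y z => ?_)
    rw [Real.coe_toNNReal _ (by positivity), Prod.dist_eq, max_le_iff]
    simp only [dist_eq_norm]
    have h1 : ‖y.1 - z.1‖ ≤ ‖y - z‖ := norm_fst_le (y - z)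
    have h2 : ‖y.2 - z.2‖ ≤ ‖y - z‖ := norm_snd_le (y - z)
    constructor
    · nlinarith [norm_nonneg (y - z)]
    · rw [← mul_sub, norm_mul]
      calc ‖p t‖ * ‖y.1 - z.1‖ ≤ K * ‖y - z‖ := by gcongr; exact hK t
        _ ≤ _ := by nlinarith [norm_nonneg (y - z)]
  have := ODE_solution_unique_univ (v := fun t (y : ℂ × ℂ) => ((y.2, p t * y.1) : ℂ × ℂ))
    (s := fun _ => Set.univ) (t₀ := a) hl
    (f := fun x => (u x, u' x)) (g := fun _ => (0, 0))
    (fun t => ⟨(hu t).prodMk (hu' t), trivial⟩)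
    (fun t => ⟨(hasDerivAt_const t ((0, 0) : ℂ × ℂ)).congr_deriv
      (Prod.ext (by simp) (by simp)), trivial⟩)
    (by simp [h0, h0'])
  funext x
  exact congrArg Prod.fst (congrFun this x)

/-! ### Regularity of functions with weak derivatives -/

theorem HasCompactSupport.exists_subset_Ioo {E : Type*} [Zero E] {f : ℝ → E}
    (hf : HasCompactSupport f) :
    ∃ R₀ : ℝ, 0 < R₀ ∧ ∀ R, R₀ ≤ R → ∀ x, x ∉ Set.Ioo (-R) R → f x = 0 := by
  obtain ⟨r, hr⟩ := hf.isCompact.isBounded.subset_ball (0 : ℝ)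
  refine ⟨max r 1, by positivity, fun R hR x hx => ?_⟩
  by_contra h
  have h1 := hr (subset_tsupport f (Function.mem_support.2 h))
  rw [Real.ball_eq_Ioo] at h1
  refine hx ⟨?_, ?_⟩ <;> have := le_max_left r 1 <;> linarith [h1.1, h1.2]

/-- A smooth compactly supported function of zero mean is the derivative of another one. -/
theorem exists_contDiff_primitive {θ : ℝ → ℝ} (hθ : ContDiff ℝ ∞ θ) (hc : HasCompactSupport θ)
    (h0 : ∫ x, θ x = 0) :
    ∃ φ : ℝ → ℝ, ContDiff ℝ ∞ φ ∧ HasCompactSupport φ ∧ deriv φ = θ := by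
  obtain ⟨R, hR, hsupp⟩ := hc.exists_subset_Ioo
  replace hsupp := hsupp R le_rfl
  have hd : ∀ x, HasDerivAt (fun x => ∫ t in (-R)..x, θ t) (θ x) x := fun x =>
    (hθ.continuous.integral_hasStrictDerivAt _ x).hasDerivAt
  have hderiv : deriv (fun x => ∫ t in (-R)..x, θ t) = θ := funext fun x => (hd x).deriv
  refine ⟨fun x => ∫ t in (-R)..x, θ t, ?_, ?_, hderiv⟩
  · rw [contDiff_infty_iff_deriv]
    exact ⟨fun x => (hd x).differentiableAt, by rwa [hderiv]⟩
  · refine HasCompactSupport.intro (isCompact_Icc (a := -R) (b := R)) fun x hx => ?_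
    rcases lt_or_ge x (-R) with h | h
    · rw [intervalIntegral.integral_congr (g := fun _ => 0), intervalIntegral.integral_zero]
      intro t ht
      rw [Set.uIcc_of_ge h.le] at ht
      exact hsupp t fun h' => by linarith [h'.1, ht.2]
    · have h' : R < x := by
        by_contra h2
        exact hx ⟨h, not_lt.1 h2⟩
      rw [intervalIntegral.integral_of_le h, setIntegral_eq_integral_of_forall_compl_eq_zero, h0]
      intro t ht
      exact hsupp t fun h2 => ht ⟨h2.1, h2.2.le.trans h'.le⟩

/-- Du Bois-Reymond: a function whose weak derivative vanishes is constant. -/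
theorem ae_eq_const_of_weakDeriv_zero {h : ℝ → ℂ} (hh : LocallyIntegrable h)
    (h0 : ∀ φ : ℝ → ℝ, ContDiff ℝ ∞ φ → HasCompactSupport φ → ∫ x, deriv φ x • h x = 0) :
    ∃ c : ℂ, h =ᵐ[volume] fun _ => c := by
  let B : ContDiffBump (0 : ℝ) := default
  let ψ : ℝ → ℝ := B.normed volume
  have hψ : ContDiff ℝ ∞ ψ := B.contDiff_normed
  have hψc : HasCompactSupport ψ := B.hasCompactSupport_normed
  have hψ1 : ∫ x, ψ x = 1 := B.integral_normed
  refine ⟨∫ x, ψ x • h x, ?_⟩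
  refine ae_eq_of_integral_contDiff_smul_eq hh (locallyIntegrable_const _) fun χ hχ hχc => ?_
  have hi : ∀ η : ℝ → ℝ, Continuous η → HasCompactSupport η → Integrable fun x => η x • h x :=
    fun η h1 h2 => hh.integrable_smul_left_of_hasCompactSupport h1 h2
  set m : ℝ := ∫ x, χ x with hm
  obtain ⟨φ, hφ, hφc, hφd⟩ := exists_contDiff_primitive (θ := fun x => χ x - m * ψ x)
    (hχ.sub (contDiff_const.mul hψ)) (hχc.sub (hψc.mul_left)) (by
      rw [integral_sub (hχ.continuous.integrable_of_hasCompactSupport hχc)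
        ((hψ.continuous.integrable_of_hasCompactSupport hψc).const_mul m), integral_const_mul, hψ1]
      simp [hm])
  have h1 := h0 φ hφ hφc
  rw [hφd] at h1
  simp_rw [sub_smul, mul_smul] at h1
  have h2 : Integrable fun x => m • ψ x • h x := (hi ψ hψ.continuous hψc).smul m
  rw [integral_sub (hi χ hχ.continuous hχc) h2, integral_smul, sub_eq_zero] at h1
  rw [h1, integral_smul_const]

/-- Integration by parts against the primitive of a locally integrable function. -/
theorem integral_deriv_smul_primitive {g : ℝ → ℂ} (hg : LocallyIntegrable g) {φ : ℝ → ℝ}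
    (hφ : ContDiff ℝ ∞ φ) (hc : HasCompactSupport φ) (a : ℝ) :
    ∫ x, deriv φ x • ∫ t in a..x, g t = -∫ x, φ x • g x := by
  obtain ⟨R, hR, hsupp⟩ := hc.exists_subset_Ioo
  obtain ⟨R', hR', hsupp'⟩ := hc.deriv.exists_subset_Ioo
  set r := max R R' with hr
  replace hsupp := hsupp r (le_max_left _ _)
  replace hsupp' := hsupp' r (le_max_right _ _)
  have hr0 : 0 < r := hR.trans_le (le_max_left _ _)
  have hφd : Continuous (deriv φ) := hφ.continuous_deriv (by simp)
  have hgi : ∀ x y, IntervalIntegrable g volume x y := fun x y =>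
    (hg.integrableOn_isCompact isCompact_uIcc).intervalIntegrable
  have hFTC : ∀ x y, ∫ t in x..y, deriv φ t = φ y - φ x := fun x y =>
    intervalIntegral.integral_deriv_eq_sub (fun t _ => hφ.differentiable (by simp) t)
      (hφd.intervalIntegrable _ _)
  have hzero : ∫ x, deriv φ x = 0 := by
    rw [← setIntegral_eq_integral_of_forall_compl_eq_zero (s := Set.Ioc (-r) r)
      (fun x hx => hsupp' x fun h => hx ⟨h.1, h.2.le⟩),
      ← intervalIntegral.integral_of_le (by linarith), hFTC, hsupp _ (by simp), hsupp _ (by simp),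
      sub_zero]
  have hcontF : ∀ b, Continuous fun x => ∫ t in b..x, g t := fun b =>
    intervalIntegral.continuous_primitive hgi b
  have hbase : ∫ x, deriv φ x • ∫ t in a..x, g t = ∫ x, deriv φ x • ∫ t in (-r)..x, g t := by
    have h1 : ∀ x, deriv φ x • ∫ t in a..x, g t =
        deriv φ x • (∫ t in (-r)..x, g t) + deriv φ x • ∫ t in a..(-r), g t := fun x => by
      rw [← smul_add, add_comm, intervalIntegral.integral_add_adjacent_intervals (hgi _ _) (hgi _ _)]
    simp_rw [h1]
    rw [integral_add, integral_smul_const, hzero, zero_smul, add_zero]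
    · exact (hφd.smul (hcontF _)).integrable_of_hasCompactSupport hc.deriv.smul_right
    · exact (hφd.integrable_of_hasCompactSupport hc.deriv).smul_const _
  rw [hbase]
  set μ : Measure ℝ := volume.restrict (Set.Ioc (-r) r) with hμ
  have hgμ : Integrable g μ := (hgi (-r) r).1
  have hφμ : Integrable (deriv φ) μ := (hφd.integrable_of_hasCompactSupport hc.deriv).restrict
  -- the integrand of the double integral over the triangle `t ≤ x`, to which Fubini applies
  let G : ℝ → ℝ → ℂ := fun x t => if t ≤ x then deriv φ x • g t else 0
  have hG : Integrable (Function.uncurry G) (μ.prod μ) := by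
    have := (hφμ.smul_prod hgμ).indicator (measurableSet_le measurable_snd measurable_fst)
    exact this
  have hL : ∫ x, deriv φ x • ∫ t in (-r)..x, g t = ∫ x, ∫ t, G x t ∂μ ∂μ := by
    rw [← setIntegral_eq_integral_of_forall_compl_eq_zero (s := Set.Ioc (-r) r)
      (fun x hx => by rw [hsupp' x fun h => hx ⟨h.1, h.2.le⟩, zero_smul])]
    refine setIntegral_congr_fun measurableSet_Ioc fun x hx => ?_
    have h2 : ∀ t, G x t = (Set.Iic x).indicator (fun t => deriv φ x • g t) t := fun t => by
      simp only [G, Set.indicator, Set.mem_Iic]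
    simp_rw [h2]
    rw [integral_indicator measurableSet_Iic, hμ, Measure.restrict_restrict measurableSet_Iic,
      integral_smul, intervalIntegral.integral_of_le hx.1.le]
    congr 3
    ext t
    simp only [Set.mem_Ioc, Set.mem_inter_iff, Set.mem_Iic]
    exact ⟨fun h => ⟨h.2, h.1, h.2.trans hx.2⟩, fun h => ⟨h.2.1, h.1⟩⟩
  have hRt : ∫ t, ∫ x, G x t ∂μ ∂μ = -∫ x, φ x • g x := by
    rw [← setIntegral_eq_integral_of_forall_compl_eq_zero (f := fun x => φ x • g x)
      (s := Set.Ioc (-r) r) (fun x hx => by rw [hsupp x fun h => hx ⟨h.1, h.2.le⟩, zero_smul]),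
      ← integral_neg]
    refine setIntegral_congr_fun measurableSet_Ioc fun t ht => ?_
    have h2 : ∀ x, G x t = (Set.Ici t).indicator (fun x => deriv φ x • g t) x := fun x => by
      simp only [G, Set.indicator, Set.mem_Ici]
    simp_rw [h2]
    rw [integral_indicator measurableSet_Ici, hμ, Measure.restrict_restrict measurableSet_Ici,
      integral_smul_const]
    have h3 : Set.Ici t ∩ Set.Ioc (-r) r = Set.Icc t r := by
      ext x
      simp only [Set.mem_Ioc, Set.mem_inter_iff, Set.mem_Ici, Set.mem_Icc]
      exact ⟨fun h => ⟨h.1, h.2.2⟩, fun h => ⟨h.1, ht.1.trans_le h.1, h.2⟩⟩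
    rw [h3, integral_Icc_eq_integral_Ioc, ← intervalIntegral.integral_of_le ht.2, hFTC,
      hsupp r (by simp), zero_sub, neg_smul]
  rw [hL, ← hRt]
  exact integral_integral_swap hG

theorem L2R.locallyIntegrable (f : L2R) : LocallyIntegrable f :=
  (Lp.memLp f).locallyIntegrable (by norm_num)

/-- A function with a weak derivative is almost everywhere equal to a primitive of it. -/
theorem HasWeakDeriv.exists_ae_eq {f g : L2R} (h : HasWeakDeriv f g) :
    ∃ c : ℂ, f =ᵐ[volume] fun x => c + ∫ t in (0 : ℝ)..x, g t := by
  have hgi : ∀ x y, IntervalIntegrable g volume x y := fun x y =>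
    (g.locallyIntegrable.integrableOn_isCompact isCompact_uIcc).intervalIntegrable
  have hcont : Continuous fun x => ∫ t in (0 : ℝ)..x, g t :=
    intervalIntegral.continuous_primitive hgi 0
  obtain ⟨c, hc⟩ := ae_eq_const_of_weakDeriv_zero
    (h := fun x => f x - ∫ t in (0 : ℝ)..x, g t)
    (f.locallyIntegrable.sub hcont.locallyIntegrable) fun φ hφ hφc => by
      have hφd : Continuous (deriv φ) := hφ.continuous_deriv (by simp)
      have hi : Integrable fun x => deriv φ x • ∫ t in (0 : ℝ)..x, g t :=
        (hφd.smul hcont).integrable_of_hasCompactSupport hφc.deriv.smul_right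
      simp_rw [smul_sub]
      rw [integral_sub (f.integrable_smul hφd hφc.deriv) hi, h φ hφ hφc,
        integral_deriv_smul_primitive g.locallyIntegrable hφ hφc, sub_self]
  refine ⟨c, ?_⟩
  filter_upwards [hc] with x hx
  rw [← hx]
  ring

/-- If the second weak derivative of `u` equals `p u + r` with continuous `p` and `r`, then `u` has
a classical representative solving the same differential equation. -/
theorem HasWeakDeriv.exists_classical {u u' u'' : L2R} (h1 : HasWeakDeriv u u')
    (h2 : HasWeakDeriv u' u'') {p r : ℝ → ℂ} (hp : Continuous p) (hr : Continuous r)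
    (heq : u'' =ᵐ[volume] fun x => p x * u x + r x) :
    ∃ f f' : ℝ → ℂ, u =ᵐ[volume] f ∧ u' =ᵐ[volume] f' ∧ (∀ x, HasDerivAt f (f' x) x) ∧
      ∀ x, HasDerivAt f' (p x * f x + r x) x := by
  obtain ⟨c, hc⟩ := h1.exists_ae_eq
  obtain ⟨d, hd⟩ := h2.exists_ae_eq
  have hii : ∀ g : L2R, ∀ x y, IntervalIntegrable g volume x y := fun g x y =>
    (g.locallyIntegrable.integrableOn_isCompact isCompact_uIcc).intervalIntegrable
  have hf' : Continuous fun x => d + ∫ t in (0 : ℝ)..x, u'' t :=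
    continuous_const.add (intervalIntegral.continuous_primitive (hii u'') 0)
  have hf : ∀ x, HasDerivAt (fun x => c + ∫ t in (0 : ℝ)..x, u' t)
      (d + ∫ t in (0 : ℝ)..x, u'' t) x := fun x => by
    have h3 : ∀ x, ∫ t in (0 : ℝ)..x, u' t = ∫ t in (0 : ℝ)..x, (d + ∫ s in (0 : ℝ)..t, u'' s) :=
      fun x => intervalIntegral.integral_congr_ae (hd.mono fun t ht _ => ht)
    simp_rw [h3]
    exact (hf'.integral_hasStrictDerivAt 0 x).hasDerivAt.const_add c
  have hfc : Continuous fun x => c + ∫ t in (0 : ℝ)..x, u' t :=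
    continuous_iff_continuousAt.2 fun x => (hf x).continuousAt
  refine ⟨_, _, hc, hd, hf, fun x => ?_⟩
  have h4 : ∀ x, ∫ t in (0 : ℝ)..x, u'' t =
      ∫ t in (0 : ℝ)..x, (p t * (c + ∫ s in (0 : ℝ)..t, u' s) + r t) := fun x => by
    refine intervalIntegral.integral_congr_ae ?_
    filter_upwards [heq, hc] with t ht ht' _
    rw [ht, ht']
  simp_rw [h4]
  exact ((((hp.mul hfc).add hr).integral_hasStrictDerivAt 0 x).hasDerivAt.const_add d)

/-- A classical derivative in `L₂(ℝ)` is a weak derivative. -/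
theorem hasWeakDeriv_of_hasDerivAt {f f' : ℝ → ℂ} (hd : ∀ x, HasDerivAt f (f' x) x)
    (hf : MemLp f 2 volume) (hf' : MemLp f' 2 volume) :
    HasWeakDeriv (hf.toLp f) (hf'.toLp f') := by
  intro φ hφ hc
  have hφd : Continuous (deriv φ) := hφ.continuous_deriv (by simp)
  have hfl : LocallyIntegrable f := hf.locallyIntegrable (by norm_num)
  have hfl' : LocallyIntegrable f' := hf'.locallyIntegrable (by norm_num)
  have h1 : ∫ x, deriv φ x • (hf.toLp f) x = ∫ x, deriv φ x • f x :=
    integral_congr_ae (hf.coeFn_toLp.mono fun x hx => by simp only [hx])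
  have h2 : ∫ x, φ x • (hf'.toLp f') x = ∫ x, φ x • f' x :=
    integral_congr_ae (hf'.coeFn_toLp.mono fun x hx => by simp only [hx])
  rw [h1, h2]
  have h3 := integral_bilinear_hasDerivAt_right_eq_neg_left_of_integrable
    (L := ContinuousLinearMap.lsmul ℝ ℝ) (u := φ) (v := f) (u' := deriv φ) (v' := f')
    (fun x _ => (hφ.differentiable (by simp) x).hasDerivAt) (fun x _ => hd x)
    (hfl'.integrable_smul_left_of_hasCompactSupport hφ.continuous hc)
    (hfl.integrable_smul_left_of_hasCompactSupport hφd hc.deriv)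
    (hfl.integrable_smul_left_of_hasCompactSupport hφ.continuous hc)
  simp only [ContinuousLinearMap.lsmul_apply] at h3
  rw [h3, neg_neg]

/-! ### Averaging of rapidly oscillating profiles -/

/-- A continuous profile `F = F(x, ξ)` which is `1`-periodic in `ξ` with zero mean over the period,
vanishes for `x ≤ a` and for `b ≤ x`, and has the continuous partial derivative `F₁` in `x`. -/
structure IsOscillatingProfile (a b : ℝ) (F F₁ : ℝ → ℝ → ℂ) : Prop where
  continuous : Continuous (Function.uncurry F)
  continuous_deriv : Continuous (Function.uncurry F₁)
  hasDerivAt : ∀ x ξ, HasDerivAt (fun y => F y ξ) (F₁ x ξ) x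
  periodic : ∀ x ξ, F x (ξ + 1) = F x ξ
  mean : ∀ x, ∫ ξ in (0 : ℝ)..1, F x ξ = 0
  left : ∀ x ξ, x ≤ a → F x ξ = 0
  right : ∀ x ξ, b ≤ x → F x ξ = 0

theorem hasDerivAt_intervalIntegral_param {F F₁ : ℝ → ℝ → ℂ}
    (hF : Continuous (Function.uncurry F)) (hF₁ : Continuous (Function.uncurry F₁))
    (hd : ∀ x ξ, HasDerivAt (fun y => F y ξ) (F₁ x ξ) x) (c d x : ℝ) :
    HasDerivAt (fun y => ∫ τ in c..d, F y τ) (∫ τ in c..d, F₁ x τ) x := by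
  obtain ⟨C, hC⟩ := ((isCompact_closedBall x 1).prod (isCompact_uIcc (a := c) (b := d)))
    |>.exists_bound_of_continuousOn hF₁.continuousOn
  have hc : ∀ G : ℝ → ℝ → ℂ, Continuous (Function.uncurry G) → ∀ y, Continuous (G y) :=
    fun G hG y => hG.comp (Continuous.prodMk_right y)
  refine (intervalIntegral.hasDerivAt_integral_of_dominated_loc_of_deriv_le
    (Metric.closedBall_mem_nhds x one_pos)
    (Eventually.of_forall fun y => (hc F hF y).aestronglyMeasurable)
    ((hc F hF x).intervalIntegrable _ _) (hc F₁ hF₁ x).aestronglyMeasurable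
    (bound := fun _ => C) (Eventually.of_forall fun t ht y hy => ?_)
    (by simp) (Eventually.of_forall fun t _ y _ => hd y t)).2
  exact hC (y, t) ⟨hy, Set.uIoc_subset_uIcc ht⟩

/-- The total derivative of `x ↦ F(x, x/ε)`. -/
theorem hasDerivAt_comp_div {F F₁ F₂ : ℝ → ℝ → ℂ} (h₁ : Continuous (Function.uncurry F₁))
    (h₂ : Continuous (Function.uncurry F₂)) (hd₁ : ∀ x ξ, HasDerivAt (fun y => F y ξ) (F₁ x ξ) x)
    (hd₂ : ∀ x ξ, HasDerivAt (fun η => F x η) (F₂ x ξ) ξ) (ε x : ℝ) :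
    HasDerivAt (fun y => F y (y / ε)) (F₁ x (x / ε) + (ε : ℂ)⁻¹ * F₂ x (x / ε)) x := by
  let c : ℂ →L[ℝ] (ℝ →L[ℝ] ℂ) := ContinuousLinearMap.smulRightL ℝ ℝ ℂ 1
  have hfd := hasStrictFDerivAt_uncurry_coprod (𝕜 := ℝ) (u := (x, x / ε)) (f := F)
    (f₁ := fun x ξ => c (F₁ x ξ)) (f₂ := fun x ξ => c (F₂ x ξ))
    (Eventually.of_forall fun v => (hd₁ v.1 v.2).hasFDerivAt)
    (Eventually.of_forall fun v => (hd₂ v.1 v.2).hasFDerivAt)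
    (c.continuous.comp h₁).continuousAt (c.continuous.comp h₂).continuousAt
  have hin : HasDerivAt (fun y : ℝ => (y, y / ε)) (1, 1 / ε) x :=
    (hasDerivAt_id x).prodMk ((hasDerivAt_id x).div_const ε)
  have := hfd.hasFDerivAt.comp_hasDerivAt x hin
  refine this.congr_deriv ?_
  simp [c, Function.HasUncurry.uncurry]

theorem uncurry_fastPrimitive_continuous {F : ℝ → ℝ → ℂ} (hF : Continuous (Function.uncurry F)) :
    Continuous (Function.uncurry (fastPrimitive F)) := by
  have h1 : Continuous fun p : ℝ × ℝ => ∫ τ in (0 : ℝ)..p.2, F p.1 τ :=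
    intervalIntegral.continuous_parametric_intervalIntegral_of_continuous
      (f := fun (p : ℝ × ℝ) τ => F p.1 τ)
      (hF.comp (by fun_prop : Continuous fun q : (ℝ × ℝ) × ℝ => (q.1.1, q.2))) continuous_snd
  have h2 : Continuous fun p : ℝ × ℝ => ∫ τ in (0 : ℝ)..1, (τ : ℂ) * F p.1 τ :=
    intervalIntegral.continuous_parametric_intervalIntegral_of_continuous'
      (f := fun (p : ℝ × ℝ) τ => (τ : ℂ) * F p.1 τ)
      ((by fun_prop : Continuous fun q : (ℝ × ℝ) × ℝ => (q.2 : ℂ)).mul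
        (hF.comp (by fun_prop : Continuous fun q : (ℝ × ℝ) × ℝ => (q.1.1, q.2)))) _ _
  exact h1.add h2

theorem continuous_comp_div_right {F : ℝ → ℝ → ℂ} (h : Continuous (Function.uncurry F)) (ε : ℝ) :
    Continuous fun x => F x (x / ε) :=
  h.comp (continuous_id.prodMk (continuous_id.div_const ε))

theorem exists_bound_of_periodic_right {G : ℝ → ℝ → ℂ} (hG : Continuous (Function.uncurry G))
    (hper : ∀ x ξ, G x (ξ + 1) = G x ξ) (a b : ℝ) :
    ∃ M, 0 ≤ M ∧ ∀ x ∈ Set.Icc a b, ∀ ξ, ‖G x ξ‖ ≤ M := by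
  obtain ⟨C, hC⟩ := ((isCompact_Icc (a := a) (b := b)).prod (isCompact_Icc (a := (0 : ℝ)) (b := 1)))
    |>.exists_bound_of_continuousOn hG.continuousOn
  refine ⟨max C 0, le_max_right _ _, fun x hx ξ => le_max_of_le_left ?_⟩
  have hp : Function.Periodic (G x) 1 := hper x
  obtain ⟨η, hη, h1⟩ := hp.exists_mem_Ico₀ one_pos ξ
  rw [h1]
  exact hC (x, η) ⟨hx, hη.1, hη.2.le⟩

theorem norm_intervalIntegral_le_of_mem_Icc {f : ℝ → ℂ} {a b x C : ℝ} (hx : x ∈ Set.Icc a b)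
    (hC0 : 0 ≤ C)
    (hC : ∀ t ∈ Set.Icc a b, ‖f t‖ ≤ C) : ‖∫ t in a..x, f t‖ ≤ C * (b - a) := by
  refine (intervalIntegral.norm_integral_le_of_norm_le_const (C := C) fun t ht => ?_).trans ?_
  · rw [Set.uIoc_of_le hx.1] at ht
    exact hC t ⟨ht.1.le, ht.2.trans hx.2⟩
  · rw [abs_of_nonneg (sub_nonneg.2 hx.1)]
    gcongr
    exact hx.2

namespace IsOscillatingProfile

variable {a b : ℝ} {F F₁ : ℝ → ℝ → ℂ}

theorem continuous_right (h : IsOscillatingProfile a b F F₁) (x : ℝ) : Continuous (F x) :=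
  h.continuous.comp (Continuous.prodMk_right x)

theorem periodic_deriv (h : IsOscillatingProfile a b F F₁) (x ξ : ℝ) :
    F₁ x (ξ + 1) = F₁ x ξ := by
  have h1 := h.hasDerivAt x (ξ + 1)
  simp_rw [h.periodic] at h1
  exact h1.unique (h.hasDerivAt x ξ)

theorem mean_deriv (h : IsOscillatingProfile a b F F₁) (x : ℝ) :
    ∫ ξ in (0 : ℝ)..1, F₁ x ξ = 0 := by
  have h1 := hasDerivAt_intervalIntegral_param h.continuous h.continuous_deriv h.hasDerivAt 0 1 x
  simp_rw [h.mean] at h1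
  exact h1.unique (hasDerivAt_const x 0)

theorem hasDerivAt_fastPrimitive (h : IsOscillatingProfile a b F F₁) (x ξ : ℝ) :
    HasDerivAt (fun y => fastPrimitive F y ξ) (fastPrimitive F₁ x ξ) x := by
  have hu : Continuous fun p : ℝ × ℝ => (p.2 : ℂ) := by fun_prop
  exact (hasDerivAt_intervalIntegral_param h.continuous h.continuous_deriv h.hasDerivAt 0 ξ x).add
    (hasDerivAt_intervalIntegral_param (F := fun x τ => (τ : ℂ) * F x τ)
      (F₁ := fun x τ => (τ : ℂ) * F₁ x τ) (hu.mul h.continuous) (hu.mul h.continuous_deriv)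
      (fun x τ => (h.hasDerivAt x τ).const_mul (τ : ℂ)) 0 1 x)

theorem hasDerivAt_fastPrimitive_fast (h : IsOscillatingProfile a b F F₁) (x ξ : ℝ) :
    HasDerivAt (fun η => fastPrimitive F x η) (F x ξ) ξ :=
  ((h.continuous_right x).integral_hasStrictDerivAt 0 ξ).hasDerivAt.add_const _

theorem fastPrimitive_profile (h : IsOscillatingProfile a b F F₁) :
    IsOscillatingProfile a b (fastPrimitive F) (fastPrimitive F₁) where
  continuous := uncurry_fastPrimitive_continuous h.continuous
  continuous_deriv := uncurry_fastPrimitive_continuous h.continuous_deriv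
  hasDerivAt := h.hasDerivAt_fastPrimitive
  periodic x ξ := by
    have hi : ∀ c d, IntervalIntegrable (F x) volume c d := fun c d =>
      (h.continuous_right x).intervalIntegrable c d
    have h1 : ∫ τ in ξ..ξ + 1, F x τ = 0 := by
      have hper : Function.Periodic (F x) 1 := h.periodic x
      rw [hper.intervalIntegral_add_eq ξ 0, zero_add, h.mean]
    rw [fastPrimitive, fastPrimitive,
      ← intervalIntegral.integral_add_adjacent_intervals (hi 0 ξ) (hi ξ (ξ + 1)), h1, add_zero]
  mean x := by
    have hF := h.continuous_right x
    have hΦ : ∀ ξ, HasDerivAt (fun η : ℝ => (η : ℂ) * ∫ τ in (0 : ℝ)..η, F x τ)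
        ((∫ τ in (0 : ℝ)..ξ, F x τ) + (ξ : ℂ) * F x ξ) ξ := fun ξ => by
      refine ((Complex.ofRealCLM.hasDerivAt (x := ξ)).mul
        (hF.integral_hasStrictDerivAt 0 ξ).hasDerivAt).congr_deriv ?_
      simp
    have hc1 : Continuous fun ξ => ∫ τ in (0 : ℝ)..ξ, F x τ :=
      intervalIntegral.continuous_primitive (fun c d => hF.intervalIntegrable c d) 0
    have hc2 : Continuous fun ξ : ℝ => (ξ : ℂ) * F x ξ := by fun_prop
    have h2 := intervalIntegral.integral_eq_sub_of_hasDerivAt (a := 0) (b := 1)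
      (fun ξ _ => hΦ ξ) ((hc1.add hc2).intervalIntegrable _ _)
    rw [h.mean, intervalIntegral.integral_add (hc1.intervalIntegrable _ _)
      (hc2.intervalIntegrable _ _)] at h2
    simp only [fastPrimitive]
    rw [intervalIntegral.integral_add (hc1.intervalIntegrable _ _)
      (continuous_const.intervalIntegrable _ _)]
    simpa using h2
  left x ξ hx := by simp [fastPrimitive, h.left x _ hx]
  right x ξ hx := by simp [fastPrimitive, h.right x _ hx]

/-- The oscillating integral gains a factor `ε`. -/
theorem integral_comp_div (h : IsOscillatingProfile a b F F₁) {ε : ℝ} (hε : ε ≠ 0) (x : ℝ) :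
    ∫ t in a..x, F t (t / ε) =
      ε * (fastPrimitive F x (x / ε) - ∫ t in a..x, fastPrimitive F₁ t (t / ε)) := by
  have hP := h.fastPrimitive_profile
  have hc1 := continuous_comp_div_right hP.continuous_deriv ε
  have hc2 : Continuous fun t => (ε : ℂ)⁻¹ * F t (t / ε) :=
    continuous_const.mul (continuous_comp_div_right h.continuous ε)
  have h1 := intervalIntegral.integral_eq_sub_of_hasDerivAt (a := a) (b := x)
    (fun t _ => hasDerivAt_comp_div hP.continuous_deriv h.continuous hP.hasDerivAt
      h.hasDerivAt_fastPrimitive_fast ε t)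
    ((hc1.add hc2).intervalIntegrable _ _)
  rw [intervalIntegral.integral_add (hc1.intervalIntegrable _ _)
    (hc2.intervalIntegrable _ _), intervalIntegral.integral_const_mul,
    hP.left a _ le_rfl, sub_zero] at h1
  have hε' : (ε : ℂ) ≠ 0 := by exact_mod_cast hε
  rw [← h1]
  field_simp
  ring

theorem integral_comp_div_right (h : IsOscillatingProfile a b F F₁) {ε : ℝ} (hε : ε ≠ 0) :
    ∫ t in a..b, F t (t / ε) = -(ε * ∫ t in a..b, fastPrimitive F₁ t (t / ε)) := by
  rw [h.integral_comp_div hε, h.fastPrimitive_profile.right b _ le_rfl]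
  ring

/-- The square of a profile minus its mean over the period is again a profile. -/
theorem sq_sub_mean (h : IsOscillatingProfile a b F F₁) :
    IsOscillatingProfile a b (fun x ξ => F x ξ ^ 2 - ∫ τ in (0 : ℝ)..1, F x τ ^ 2)
      (fun x ξ => 2 * F x ξ * F₁ x ξ - ∫ τ in (0 : ℝ)..1, 2 * F x τ * F₁ x τ) where
  continuous := by
    have h1 : Continuous fun p : ℝ × ℝ => F p.1 p.2 := h.continuous
    have h2 : Continuous fun x => ∫ τ in (0 : ℝ)..1, F x τ ^ 2 :=
      intervalIntegral.continuous_parametric_intervalIntegral_of_continuous'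
        (f := fun x τ => F x τ ^ 2) ((continuous_pow 2).comp h1) 0 1
    exact (h1.pow 2).sub (h2.comp continuous_fst)
  continuous_deriv := by
    have h1 : Continuous fun p : ℝ × ℝ => 2 * F p.1 p.2 * F₁ p.1 p.2 :=
      (continuous_const.mul h.continuous).mul h.continuous_deriv
    have h2 : Continuous fun x => ∫ τ in (0 : ℝ)..1, 2 * F x τ * F₁ x τ :=
      intervalIntegral.continuous_parametric_intervalIntegral_of_continuous'
        (f := fun x τ => 2 * F x τ * F₁ x τ) h1 0 1
    exact h1.sub (h2.comp continuous_fst)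
  hasDerivAt x ξ := by
    have hd : ∀ x ξ, HasDerivAt (fun y => F y ξ ^ 2) (2 * F x ξ * F₁ x ξ) x := fun x ξ => by
      simpa using (h.hasDerivAt x ξ).fun_pow 2
    have h1 : Continuous fun p : ℝ × ℝ => 2 * F p.1 p.2 * F₁ p.1 p.2 :=
      (continuous_const.mul h.continuous).mul h.continuous_deriv
    exact (hd x ξ).sub (hasDerivAt_intervalIntegral_param (F := fun x τ => F x τ ^ 2)
      (F₁ := fun x τ => 2 * F x τ * F₁ x τ) ((continuous_pow 2).comp h.continuous) h1 hd 0 1 x)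
  periodic x ξ := by simp only [h.periodic]
  mean x := by
    have h1 : Continuous fun ξ => F x ξ ^ 2 := (continuous_pow 2).comp (h.continuous_right x)
    rw [intervalIntegral.integral_sub (h1.intervalIntegrable _ _)
      (continuous_const.intervalIntegrable _ _)]
    simp
  left x ξ hx := by simp [h.left x _ hx]
  right x ξ hx := by simp [h.right x _ hx]

end IsOscillatingProfile

theorem IsOscillatingPotential.exists_profiles {V : ℝ → ℝ → ℂ} (hV : IsOscillatingPotential V)
    (hmean : ∀ x : ℝ, ∫ ξ in (0 : ℝ)..1, V x ξ = 0) :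
    ∃ a b : ℝ, a < b ∧ ∃ V₁ V₂ V₃ : ℝ → ℝ → ℂ, IsOscillatingProfile a b V V₁ ∧
      IsOscillatingProfile a b V₁ V₂ ∧ IsOscillatingProfile a b V₂ V₃ := by
  obtain ⟨x₀, x₁, hs⟩ := hV.support
  -- enlarging the segment makes `V` vanish at the end points `a` and `b` too
  set a := x₀ - 1
  set b := max x₀ x₁ + 1
  have hab : a < b := by have := le_max_left x₀ x₁; simp only [a, b]; linarith
  -- differentiation in the slow variable
  let D : (ℝ × ℝ → ℂ) → ℝ × ℝ → ℂ := fun W p => fderiv ℝ W p (1, 0)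
  have hD : ∀ W, ContDiff ℝ ∞ W → ContDiff ℝ ∞ (D W) := fun W hW =>
    (hW.fderiv_right (by simp)).clm_apply contDiff_const
  have hDd : ∀ W, ContDiff ℝ ∞ W → ∀ x ξ, HasDerivAt (fun y => W (y, ξ)) (D W (x, ξ)) x := by
    intro W hW x ξ
    have h1 := (hW.differentiable (by simp) (x, ξ)).hasFDerivAt
    exact h1.comp_hasDerivAt x ((hasDerivAt_id x).prodMk (hasDerivAt_const x ξ))
  have key : ∀ W, ContDiff ℝ ∞ W → (∀ x ξ, W (x, ξ + 1) = W (x, ξ)) →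
      (∀ x, ∫ ξ in (0 : ℝ)..1, W (x, ξ) = 0) → (∀ x ξ, x ∉ Set.Icc x₀ x₁ → W (x, ξ) = 0) →
      IsOscillatingProfile a b (fun x ξ => W (x, ξ)) (fun x ξ => D W (x, ξ)) ∧
      (∀ x ξ, x ∉ Set.Icc x₀ x₁ → D W (x, ξ) = 0) := by
    intro W hW hper hm hsupp
    refine ⟨⟨hW.continuous, (hD W hW).continuous, hDd W hW, hper, hm, fun x ξ hx => hsupp x ξ ?_,
      fun x ξ hx => hsupp x ξ ?_⟩, fun x ξ hx => ?_⟩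
    · intro h; have := h.1; simp only [a] at hx; linarith
    · intro h; have := h.2; have := le_max_right x₀ x₁; simp only [b] at hx; linarith
    · refine (hDd W hW x ξ).unique ((hasDerivAt_const x (0 : ℂ)).congr_of_eventuallyEq ?_)
      filter_upwards [isClosed_Icc.isOpen_compl.mem_nhds hx] with y hy
      exact hsupp y ξ hy
  obtain ⟨h1, s1⟩ := key (fun p => V p.1 p.2) hV.smooth hV.periodic hmean fun x ξ hx =>
    image_eq_zero_of_notMem_tsupport (f := fun y => V y ξ) fun h => hx (hs _ h)
  obtain ⟨h2, s2⟩ := key _ (hD _ hV.smooth) h1.periodic_deriv h1.mean_deriv s1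
  obtain ⟨h3, -⟩ := key _ (hD _ (hD _ hV.smooth)) h2.periodic_deriv h2.mean_deriv s2
  exact ⟨a, b, hab, _, _, _, h1, h2, h3⟩

/-- A common constant controls the potential `q = V(x, x/ε)` and its primitive `Q`. The mean value of
`Q²` produces `k₂`; the smallness of `Q b` comes from integrating by parts three times. -/
theorem IsOscillatingPotential.exists_primitive_bounds {V : ℝ → ℝ → ℂ}
    (hV : IsOscillatingPotential V) (hmean : ∀ x : ℝ, ∫ ξ in (0 : ℝ)..1, V x ξ = 0) :
    ∃ a b M : ℝ, a < b ∧ 0 ≤ M ∧ (∀ x ξ, x ≤ a → V x ξ = 0) ∧ (∀ x ξ, b ≤ x → V x ξ = 0) ∧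
      (∀ x ξ, ‖V x ξ‖ ≤ M) ∧ ∀ ε, 0 < ε → ε ≤ 1 →
        (∀ x ∈ Set.Icc a b, ‖∫ t in a..x, V t (t / ε)‖ ≤ M * ε) ∧
        ‖∫ t in a..b, V t (t / ε)‖ ≤ M * ε ^ 3 ∧
        ‖(∫ x in a..b, (∫ t in a..x, V t (t / ε)) ^ 2) - 2 * kTwo V * ε ^ 2‖ ≤ M * ε ^ 3 := by
  obtain ⟨a, b, hab, V₁, V₂, V₃, h0, h1, h2⟩ := hV.exists_profiles hmean
  have hL : 0 < b - a := sub_pos.2 hab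
  have P0 := h0.fastPrimitive_profile
  have P1 := h1.fastPrimitive_profile
  have P11 := P1.fastPrimitive_profile
  have P2 := h2.fastPrimitive_profile.fastPrimitive_profile
  have P22 := P2.fastPrimitive_profile
  have S := P0.sq_sub_mean
  have PS := S.fastPrimitive_profile
  obtain ⟨B0, B0n, hB0⟩ := exists_bound_of_periodic_right h0.continuous h0.periodic a b
  obtain ⟨B1, B1n, hB1⟩ := exists_bound_of_periodic_right P0.continuous P0.periodic a b
  obtain ⟨B2, B2n, hB2⟩ := exists_bound_of_periodic_right P11.continuous P11.periodic a b
  obtain ⟨B3, B3n, hB3⟩ := exists_bound_of_periodic_right P2.continuous P2.periodic a b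
  obtain ⟨B4, B4n, hB4⟩ := exists_bound_of_periodic_right P22.continuous_deriv P22.periodic_deriv a b
  obtain ⟨B5, B5n, hB5⟩ := exists_bound_of_periodic_right PS.continuous_deriv PS.periodic_deriv a b
  set L := b - a with hLdef
  -- `R` bounds `ε⁻² (Q - ε P[V])`
  set R := B2 + B3 * L with hR
  have hRn : 0 ≤ R := by positivity
  have hQ : ∀ ε, 0 < ε → ε ≤ 1 → ∀ x ∈ Set.Icc a b,
      ‖(∫ t in a..x, V t (t / ε)) - ε * fastPrimitive V x (x / ε)‖ ≤ R * ε ^ 2 := by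
    intro ε hε hε1 x hx
    rw [h0.integral_comp_div hε.ne', P1.integral_comp_div hε.ne']
    have e1 : (ε : ℂ) * (fastPrimitive V x (x / ε) - ε * (fastPrimitive (fastPrimitive V₁) x (x / ε)
        - ∫ t in a..x, fastPrimitive (fastPrimitive V₂) t (t / ε))) -
        ε * fastPrimitive V x (x / ε) = -((ε : ℂ) ^ 2 * (fastPrimitive (fastPrimitive V₁) x (x / ε)
        - ∫ t in a..x, fastPrimitive (fastPrimitive V₂) t (t / ε))) := by ring
    rw [e1, norm_neg, norm_mul, norm_pow, Complex.norm_real, Real.norm_of_nonneg hε.le, mul_comm]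
    gcongr
    refine (norm_sub_le _ _).trans (add_le_add (hB2 x hx _) ?_)
    exact norm_intervalIntegral_le_of_mem_Icc hx B3n fun t ht => hB3 t ht _
  have hb : b ∈ Set.Icc a b := Set.right_mem_Icc.2 hab.le
  have hVq : ∀ ε : ℝ, Continuous fun t => V t (t / ε) := fun ε =>
    continuous_comp_div_right h0.continuous ε
  refine ⟨a, b, B0 + (B1 + R) + B4 * L + (R * (2 * B1 + R) * L + B5 * L), hab, by positivity,
    h0.left, h0.right, fun x ξ => ?_, fun ε hε hε1 => ⟨fun x hx => ?_, ?_, ?_⟩⟩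
  · by_cases hx : x ∈ Set.Icc a b
    · refine (hB0 x hx ξ).trans ?_
      have : 0 ≤ (B1 + R) + B4 * L + (R * (2 * B1 + R) * L + B5 * L) := by positivity
      linarith
    · have : V x ξ = 0 := by
        by_cases hxa : x ≤ a
        · exact h0.left x ξ hxa
        · exact h0.right x ξ (le_of_not_ge fun hxb => hx ⟨(not_le.1 hxa).le, hxb⟩)
      rw [this, norm_zero]
      positivity
  · have e1 := hQ ε hε hε1 x hx
    have e2 : ‖(ε : ℂ) * fastPrimitive V x (x / ε)‖ ≤ ε * B1 := by
      rw [norm_mul, Complex.norm_real, Real.norm_of_nonneg hε.le]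
      gcongr
      exact hB1 x hx _
    have e3 : R * ε ^ 2 ≤ R * ε := by
      gcongr
      nlinarith
    have e4 := norm_add_le ((∫ t in a..x, V t (t / ε)) - ε * fastPrimitive V x (x / ε))
      (ε * fastPrimitive V x (x / ε))
    rw [sub_add_cancel] at e4
    calc _ ≤ R * ε + ε * B1 := by linarith
      _ = (B1 + R) * ε := by ring
      _ ≤ _ := by
        refine mul_le_mul_of_nonneg_right ?_ hε.le
        have : 0 ≤ B4 * L + (R * (2 * B1 + R) * L + B5 * L) := by positivity
        linarith
  · rw [h0.integral_comp_div_right hε.ne', P1.integral_comp_div_right hε.ne',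
      P2.integral_comp_div_right hε.ne']
    have e1 : ∀ I : ℂ, -((ε : ℂ) * -(ε * -(ε * I))) = -((ε : ℂ) ^ 3 * I) := fun I => by ring
    rw [e1, norm_neg, norm_mul, norm_pow, Complex.norm_real, Real.norm_of_nonneg hε.le, mul_comm]
    gcongr
    refine (norm_intervalIntegral_le_of_mem_Icc hb B4n fun t ht => hB4 t ht _).trans ?_
    have : 0 ≤ B0 + (B1 + R) + (R * (2 * B1 + R) * L + B5 * L) := by positivity
    linarith
  · set Q : ℝ → ℂ := fun x => ∫ t in a..x, V t (t / ε) with hQdef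
    have hQc : Continuous Q :=
      intervalIntegral.continuous_primitive (fun c d => (hVq ε).intervalIntegrable c d) a
    set p : ℝ → ℂ := fun x => fastPrimitive V x (x / ε) with hp
    have hpc : Continuous p := continuous_comp_div_right P0.continuous ε
    set m : ℝ → ℂ := fun x => ∫ τ in (0 : ℝ)..1, fastPrimitive V x τ ^ 2 with hm
    have hmc : Continuous m :=
      intervalIntegral.continuous_parametric_intervalIntegral_of_continuous'
        (f := fun x τ => fastPrimitive V x τ ^ 2) ((continuous_pow 2).comp P0.continuous) 0 1
    have hk : 2 * kTwo V = ∫ x in a..b, m x := by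
      rw [kTwo, intervalIntegral.integral_of_le hab.le,
        setIntegral_eq_integral_of_forall_compl_eq_zero]
      · ring
      · intro x hx
        have : ∀ τ, fastPrimitive V x τ = 0 := fun τ => by
          by_cases hxa : x ≤ a
          · exact P0.left x τ hxa
          · exact P0.right x τ (le_of_not_ge fun hxb => hx ⟨not_le.1 hxa, hxb⟩)
        simp [hm, this]
    have hii : ∀ f : ℝ → ℂ, Continuous f → IntervalIntegrable f volume a b := fun f hf =>
      hf.intervalIntegrable _ _
    have e1 : (∫ x in a..b, Q x ^ 2) - 2 * kTwo V * ε ^ 2 =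
        (∫ x in a..b, (Q x - ε * p x) * (Q x + ε * p x)) +
          (ε : ℂ) ^ 2 * ∫ x in a..b, (p x ^ 2 - m x) := by
      have e2 : ∀ x, (Q x - ε * p x) * (Q x + ε * p x) = Q x ^ 2 - (ε : ℂ) ^ 2 * p x ^ 2 :=
        fun x => by ring
      simp_rw [e2]
      rw [hk, intervalIntegral.integral_sub (hii _ (by fun_prop)) (hii _ (by fun_prop)),
        intervalIntegral.integral_sub (hii _ (by fun_prop)) (hii _ (by fun_prop)),
        intervalIntegral.integral_const_mul]
      ring
    have e3 : ‖∫ x in a..b, (Q x - ε * p x) * (Q x + ε * p x)‖ ≤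
        (R * ε ^ 2 * ((2 * B1 + R) * ε)) * L := by
      refine norm_intervalIntegral_le_of_mem_Icc hb (by positivity) fun x hx => ?_
      rw [norm_mul]
      have e4 := hQ ε hε hε1 x hx
      have e5 : ‖(ε : ℂ) * p x‖ ≤ ε * B1 := by
        rw [norm_mul, Complex.norm_real, Real.norm_of_nonneg hε.le]
        gcongr
        exact hB1 x hx _
      have e6 : R * ε ^ 2 ≤ R * ε := by
        gcongr
        nlinarith
      gcongr
      · have e7 : Q x + ε * p x = (Q x - ε * p x) + (ε * p x + ε * p x) := by ring
        rw [e7]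
        have := norm_add_le (Q x - ε * p x) (ε * p x + ε * p x)
        have := norm_add_le ((ε : ℂ) * p x) (ε * p x)
        linarith
    have e8 : ‖(ε : ℂ) ^ 2 * ∫ x in a..b, (p x ^ 2 - m x)‖ ≤ ε ^ 2 * (ε * (B5 * L)) := by
      have := S.integral_comp_div_right hε.ne'
      rw [this, norm_mul, norm_neg, norm_mul, norm_pow, Complex.norm_real,
        Real.norm_of_nonneg hε.le]
      gcongr
      exact norm_intervalIntegral_le_of_mem_Icc hb B5n fun t ht => hB5 t ht _
    change ‖(∫ x in a..b, Q x ^ 2) - 2 * kTwo V * ε ^ 2‖ ≤ _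
    rw [e1]
    refine (norm_add_le _ _).trans ((add_le_add e3 e8).trans ?_)
    have e9 : 0 ≤ (B0 + (B1 + R) + B4 * L) * ε ^ 3 := by positivity
    nlinarith

/-! ### The boundary value function of a small oscillating potential -/

/-- `u` solves `u'' = (q + k²) u` on the line, with the Cauchy data of `e^{k(x - a)}` at `a`, and
`u'` is its derivative. If `q` vanishes to the left of `a`, then `u = e^{k(x - a)}` there. -/
structure IsLeftSolution (q : ℝ → ℂ) (a : ℝ) (k : ℂ) (u u' : ℝ → ℂ) : Prop where
  init : u a = 1
  init_deriv : u' a = k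
  hasDerivAt : ∀ x, HasDerivAt u (u' x) x
  hasDerivAt_deriv : ∀ x, HasDerivAt u' ((q x + k ^ 2) * u x) x

theorem norm_le_exp_of_norm_deriv_le {E : Type*} [NormedAddCommGroup E] [NormedSpace ℝ E]
    {f f' : ℝ → E} {a b K δ ρ : ℝ} (hK : 1 ≤ K) (hδ : 0 ≤ δ) (hρ : 0 ≤ ρ)
    (hf : ∀ x ∈ Set.Icc a b, HasDerivAt f (f' x) x) (ha : ‖f a‖ ≤ δ)
    (hf' : ∀ x ∈ Set.Icc a b, ‖f' x‖ ≤ K * ‖f x‖ + ρ) :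
    ∀ x ∈ Set.Icc a b, ‖f x‖ ≤ (δ + ρ) * Real.exp (K * (b - a)) := by
  intro x hx
  have h1 := norm_le_gronwallBound_of_norm_deriv_right_le (f := f) (f' := f')
    (fun y hy => (hf y hy).continuousAt.continuousWithinAt)
    (fun y hy => (hf y ⟨hy.1, hy.2.le⟩).hasDerivWithinAt) ha
    (fun y hy => hf' y ⟨hy.1, hy.2.le⟩) x hx
  refine h1.trans ?_
  have hK0 : 0 < K := by linarith
  rw [gronwallBound_of_K_ne_0 hK0.ne']
  have h2 : Real.exp (K * (x - a)) ≤ Real.exp (K * (b - a)) := by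
    gcongr
    exact hx.2
  have h3 : ρ / K ≤ ρ := div_le_self hρ hK
  have h4 := Real.exp_pos (K * (x - a))
  have h5 : 0 ≤ ρ / K := by positivity
  calc δ * Real.exp (K * (x - a)) + ρ / K * (Real.exp (K * (x - a)) - 1)
      ≤ δ * Real.exp (K * (b - a)) + ρ / K * Real.exp (K * (b - a)) := by
        gcongr
        linarith
    _ ≤ δ * Real.exp (K * (b - a)) + ρ * Real.exp (K * (b - a)) := by gcongr
    _ = _ := by ring

theorem norm_sub_le_of_norm_deriv_le {f f' : ℝ → ℂ} {a b C : ℝ} (hC0 : 0 ≤ C)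
    (hf : ∀ x, HasDerivAt f (f' x) x) (hC : ∀ x ∈ Set.Icc a b, ‖f' x‖ ≤ C) :
    ∀ x ∈ Set.Icc a b, ‖f x - f a‖ ≤ C * (b - a) := by
  intro x hx
  have h1 := Convex.norm_image_sub_le_of_norm_hasDerivWithin_le (f := f) (f' := f')
    (fun y _ => (hf y).hasDerivWithinAt) hC (convex_Icc a b)
    (Set.left_mem_Icc.2 (hx.1.trans hx.2)) hx
  refine h1.trans ?_
  rw [Real.norm_of_nonneg (sub_nonneg.2 hx.1)]
  gcongr
  exact hx.2

/-- Gronwall's estimate for the system satisfied by `u` and `v = u' - Q u`. -/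
theorem norm_le_exp_of_quasi_system {Q u v r : ℝ → ℂ} {κ : ℂ} {a b δ ρ : ℝ} (hδ : 0 ≤ δ)
    (hρ : 0 ≤ ρ) (hQ : ∀ x ∈ Set.Icc a b, ‖Q x‖ ≤ 1) (hκ : ‖κ‖ ≤ 1)
    (hr : ∀ x ∈ Set.Icc a b, ‖r x‖ ≤ ρ) (hu : ∀ x, HasDerivAt u (Q x * u x + v x) x)
    (hv : ∀ x, HasDerivAt v ((κ - Q x ^ 2) * u x - Q x * v x + r x) x) (hua : ‖u a‖ ≤ δ)
    (hva : ‖v a‖ ≤ δ) :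
    ∀ x ∈ Set.Icc a b, ‖u x‖ ≤ (δ + ρ) * Real.exp (3 * (b - a)) ∧
      ‖v x‖ ≤ (δ + ρ) * Real.exp (3 * (b - a)) := by
  intro x hx
  have h1 := norm_le_exp_of_norm_deriv_le (f := fun x => (u x, v x)) (K := 3) (δ := δ) (ρ := ρ)
    (a := a) (b := b) (by norm_num) hδ hρ (fun y _ => (hu y).prodMk (hv y))
    (max_le hua hva) (fun y hy => ?_) x hx
  · exact ⟨(norm_fst_le (u x, v x)).trans h1, (norm_snd_le (u x, v x)).trans h1⟩
  · set N := ‖((u y, v y) : ℂ × ℂ)‖ with hN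
    have hu1 : ‖u y‖ ≤ N := norm_fst_le (u y, v y)
    have hv1 : ‖v y‖ ≤ N := norm_snd_le (u y, v y)
    have hN0 : 0 ≤ N := norm_nonneg _
    have hQu : ∀ z : ℂ, ‖z‖ ≤ N → ‖Q y * z‖ ≤ N := fun z hz => by
      rw [norm_mul]
      calc ‖Q y‖ * ‖z‖ ≤ 1 * N := by gcongr; exact hQ y hy
        _ = N := one_mul N
    refine max_le ?_ ?_
    · have := norm_add_le (Q y * u y) (v y)
      have := hQu _ hu1
      change ‖Q y * u y + v y‖ ≤ _
      linarith
    · change ‖(κ - Q y ^ 2) * u y - Q y * v y + r y‖ ≤ _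
      have e1 : (κ - Q y ^ 2) * u y - Q y * v y + r y =
          κ * u y - Q y * (Q y * u y) - Q y * v y + r y := by ring
      rw [e1]
      have e2 : ‖κ * u y‖ ≤ N := by
        rw [norm_mul]
        calc ‖κ‖ * ‖u y‖ ≤ 1 * N := by gcongr
          _ = N := one_mul N
      have e3 := hQu _ (hQu _ hu1)
      have e4 := hQu _ hv1
      have e5 := hr y hy
      have := norm_add_le (κ * u y - Q y * (Q y * u y) - Q y * v y) (r y)
      have := norm_sub_le (κ * u y - Q y * (Q y * u y)) (Q y * v y)
      have := norm_sub_le (κ * u y) (Q y * (Q y * u y))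
      linarith

namespace IsLeftSolution

variable {q Q : ℝ → ℂ} {a b : ℝ}

theorem hasDerivAt_quasi {k : ℂ} {u u' : ℝ → ℂ} (h : IsLeftSolution q a k u u')
    (hQ : ∀ x, HasDerivAt Q (q x) x) (x : ℝ) :
    HasDerivAt u (Q x * u x + (u' x - Q x * u x)) x ∧
      HasDerivAt (fun x => u' x - Q x * u x)
        ((k ^ 2 - Q x ^ 2) * u x - Q x * (u' x - Q x * u x)) x := by
  constructor
  · simpa using h.hasDerivAt x
  · refine ((h.hasDerivAt_deriv x).sub ((hQ x).mul (h.hasDerivAt x))).congr_deriv ?_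
    ring

theorem norm_le {k : ℂ} {u u' : ℝ → ℂ} (h : IsLeftSolution q a k u u')
    (hQd : ∀ x, HasDerivAt Q (q x) x) (hQa : Q a = 0) (hQ : ∀ x ∈ Set.Icc a b, ‖Q x‖ ≤ 1)
    (hk : ‖k‖ ≤ 1) :
    ∀ x ∈ Set.Icc a b, ‖u x‖ ≤ Real.exp (3 * (b - a)) := by
  intro x hx
  have := (norm_le_exp_of_quasi_system (r := fun _ => 0) (κ := k ^ 2) zero_le_one le_rfl hQ
    (by rw [norm_pow]; exact pow_le_one₀ (norm_nonneg _) hk) (by simp)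
    (fun x => (h.hasDerivAt_quasi hQd x).1)
    (fun x => by simpa using (h.hasDerivAt_quasi hQd x).2) (by simp [h.init])
    (by simpa [h.init_deriv, hQa] using hk) x hx).1
  simpa using this

/-- The solutions depend on `k` in a Lipschitz way. -/
theorem norm_sub_le {k l : ℂ} {u u' w w' : ℝ → ℂ} (h : IsLeftSolution q a k u u')
    (hl : IsLeftSolution q a l w w') (hQd : ∀ x, HasDerivAt Q (q x) x) (hQa : Q a = 0)
    (hQ : ∀ x ∈ Set.Icc a b, ‖Q x‖ ≤ 1) (hk : ‖k‖ ≤ 1) (hl1 : ‖l‖ ≤ 1) :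
    ∀ x ∈ Set.Icc a b, ‖u x - w x‖ ≤ 3 * Real.exp (3 * (b - a)) ^ 2 * ‖k - l‖ ∧
      ‖(u' x - Q x * u x) - (w' x - Q x * w x)‖ ≤ 3 * Real.exp (3 * (b - a)) ^ 2 * ‖k - l‖ := by
  intro x hx
  set E := Real.exp (3 * (b - a)) with hE
  have hE1 : 1 ≤ E := Real.one_le_exp (by linarith [hx.1, hx.2])
  have hr : ∀ x ∈ Set.Icc a b, ‖(k ^ 2 - l ^ 2) * w x‖ ≤ 2 * ‖k - l‖ * E := fun y hy => by
    have e1 : (k ^ 2 - l ^ 2) * w y = (k + l) * (k - l) * w y := by ring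
    rw [e1, norm_mul, norm_mul]
    have e2 : ‖k + l‖ ≤ 2 := (norm_add_le _ _).trans (by linarith)
    gcongr
    exact hl.norm_le hQd hQa hQ hl1 y hy
  have key := norm_le_exp_of_quasi_system (Q := Q) (u := fun x => u x - w x)
    (v := fun x => (u' x - Q x * u x) - (w' x - Q x * w x)) (r := fun x => (k ^ 2 - l ^ 2) * w x)
    (κ := k ^ 2) (δ := ‖k - l‖) (norm_nonneg _) (by positivity) hQ
    (by rw [norm_pow]; exact pow_le_one₀ (norm_nonneg _) hk) hr
    (fun y => ((h.hasDerivAt_quasi hQd y).1.sub (hl.hasDerivAt_quasi hQd y).1).congr_deriv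
      (by ring))
    (fun y => ((h.hasDerivAt_quasi hQd y).2.sub (hl.hasDerivAt_quasi hQd y).2).congr_deriv
      (by ring)) (by simp [h.init, hl.init])
    (by simp [h.init_deriv, hl.init_deriv, hQa]) x hx
  have e3 : (‖k - l‖ + 2 * ‖k - l‖ * E) * E ≤ 3 * E ^ 2 * ‖k - l‖ := by
    have : ‖k - l‖ ≤ ‖k - l‖ * E := le_mul_of_one_le_right (norm_nonneg _) hE1
    calc (‖k - l‖ + 2 * ‖k - l‖ * E) * E ≤ (‖k - l‖ * E + 2 * ‖k - l‖ * E) * E := by gcongr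
      _ = _ := by ring
  exact ⟨key.1.trans e3, key.2.trans e3⟩

/-- At zero energy the quasi-derivative is quadratically small and the solution is close to `1`. -/
theorem norm_zero_energy {u u' : ℝ → ℂ} {η : ℝ} (h : IsLeftSolution q a 0 u u')
    (hQd : ∀ x, HasDerivAt Q (q x) x) (hQa : Q a = 0) (hQ : ∀ x ∈ Set.Icc a b, ‖Q x‖ ≤ η)
    (hη0 : 0 ≤ η) (hη1 : η ≤ 1) :
    ∀ x ∈ Set.Icc a b, ‖u' x - Q x * u x‖ ≤ η ^ 2 * Real.exp (3 * (b - a)) ^ 2 ∧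
      ‖u x - 1‖ ≤ 2 * η * Real.exp (3 * (b - a)) ^ 2 * (b - a) := by
  intro x hx
  have hab : a ≤ b := hx.1.trans hx.2
  set E := Real.exp (3 * (b - a)) with hE
  have hE1 : 1 ≤ E := Real.one_le_exp (by linarith [hx.1, hx.2])
  have hub := h.norm_le hQd hQa (fun x hx => (hQ x hx).trans hη1) (by simp)
  have hv : ∀ x ∈ Set.Icc a b, ‖u' x - Q x * u x‖ ≤ η ^ 2 * E ^ 2 := by
    intro x hx
    have := norm_le_exp_of_norm_deriv_le (K := 3) (δ := 0) (ρ := η ^ 2 * E) (a := a) (b := b)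
      (by norm_num) le_rfl (by positivity) (fun y _ => (h.hasDerivAt_quasi hQd y).2)
      (by simp [h.init_deriv, hQa]) (fun y hy => ?_) x hx
    · refine this.trans (le_of_eq ?_)
      rw [← hE]
      ring
    · have e1 : ((0 : ℂ) ^ 2 - Q y ^ 2) * u y - Q y * (u' y - Q y * u y) =
          -(Q y ^ 2 * u y) - Q y * (u' y - Q y * u y) := by ring
      rw [e1]
      refine (_root_.norm_sub_le _ _).trans ?_
      rw [norm_neg, norm_mul, norm_mul, norm_pow, add_comm]
      have := hQ y hy
      gcongr
      · linarith
      · exact hub y hy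
  refine ⟨hv x hx, ?_⟩
  have := norm_sub_le_of_norm_deriv_le (C := 2 * η * E ^ 2) (by positivity)
    (fun y => (h.hasDerivAt_quasi hQd y).1) (fun y hy => ?_) x hx
  · rwa [h.init] at this
  · refine (norm_add_le _ _).trans ?_
    have e2 := hv y hy
    have e3 : ‖Q y * u y‖ ≤ η * E := by
      rw [norm_mul]
      gcongr
      · exact hQ y hy
      · exact hub y hy
    have e4 : η ^ 2 * E ^ 2 ≤ η * E ^ 2 := by
      gcongr
      nlinarith
    have e5 : η * E ≤ η * E ^ 2 := by
      gcongr
      nlinarith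
    linarith

theorem norm_sub_one_le {k : ℂ} {u u' w w' : ℝ → ℂ} {η : ℝ} (h : IsLeftSolution q a k u u')
    (hw : IsLeftSolution q a 0 w w') (hQd : ∀ x, HasDerivAt Q (q x) x) (hQa : Q a = 0)
    (hQ : ∀ x ∈ Set.Icc a b, ‖Q x‖ ≤ η) (hη0 : 0 ≤ η) (hη1 : η ≤ 1) (hk : ‖k‖ ≤ 1) :
    ∀ x ∈ Set.Icc a b,
      ‖u x - 1‖ ≤ Real.exp (3 * (b - a)) ^ 2 * (3 * ‖k‖ + 2 * η * (b - a)) := by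
  intro x hx
  have h1 := (h.norm_sub_le hw hQd hQa (fun x hx => (hQ x hx).trans hη1) hk (by simp) x hx).1
  have h2 := (hw.norm_zero_energy hQd hQa hQ hη0 hη1 x hx).2
  have h3 := norm_add_le (u x - w x) (w x - 1)
  rw [sub_add_sub_cancel] at h3
  rw [sub_zero] at h1
  linarith

/-- The value at zero energy of the function whose zeros are the eigenvalues: the term `-∫ Q²` comes
from one integration of the equation for the quasi-derivative. -/
theorem norm_boundary_zero_le {u u' : ℝ → ℂ} {η : ℝ} (h : IsLeftSolution q a 0 u u')
    (hab : a ≤ b) (hQd : ∀ x, HasDerivAt Q (q x) x) (hQa : Q a = 0)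
    (hQ : ∀ x ∈ Set.Icc a b, ‖Q x‖ ≤ η) (hη0 : 0 ≤ η) (hη1 : η ≤ 1) :
    ‖u' b + ∫ x in a..b, Q x ^ 2‖ ≤
      η ^ 3 * (Real.exp (3 * (b - a)) ^ 2 * (2 * (b - a) + 1) * (b - a)) +
        ‖Q b‖ * Real.exp (3 * (b - a)) := by
  set E := Real.exp (3 * (b - a)) with hE
  have hL : 0 ≤ b - a := sub_nonneg.2 hab
  have hb : b ∈ Set.Icc a b := Set.right_mem_Icc.2 hab
  have hQc : Continuous Q := continuous_iff_continuousAt.2 fun x => (hQd x).continuousAt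
  have hz := h.norm_zero_energy hQd hQa hQ hη0 hη1
  have hd : ∀ x, HasDerivAt (fun x => (u' x - Q x * u x) + ∫ t in a..x, Q t ^ 2)
      (-(Q x ^ 2 * (u x - 1)) - Q x * (u' x - Q x * u x)) x := fun x => by
    have h1 : Continuous fun t => Q t ^ 2 := by fun_prop
    refine ((h.hasDerivAt_quasi hQd x).2.add
      (h1.integral_hasStrictDerivAt a x).hasDerivAt).congr_deriv ?_
    ring
  have key := norm_sub_le_of_norm_deriv_le (a := a) (b := b)
    (C := η ^ 3 * (E ^ 2 * (2 * (b - a) + 1))) (by positivity) hd (fun x hx => ?_) b hb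
  · simp only [h.init_deriv, hQa, intervalIntegral.integral_same] at key
    have e1 : u' b + ∫ x in a..b, Q x ^ 2 =
        ((u' b - Q b * u b + ∫ t in a..b, Q t ^ 2) - (0 - 0 * u a + 0)) + Q b * u b := by ring
    rw [e1]
    refine (norm_add_le _ _).trans (add_le_add (key.trans (le_of_eq (by ring))) ?_)
    rw [norm_mul]
    gcongr
    exact h.norm_le hQd hQa (fun x hx => (hQ x hx).trans hη1) (by simp) b hb
  · refine (_root_.norm_sub_le _ _).trans ?_
    rw [norm_neg, norm_mul, norm_mul, norm_pow]
    obtain ⟨e1, e2⟩ := hz x hx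
    have e3 := hQ x hx
    calc ‖Q x‖ ^ 2 * ‖u x - 1‖ + ‖Q x‖ * ‖u' x - Q x * u x‖
        ≤ η ^ 2 * (2 * η * E ^ 2 * (b - a)) + η * (η ^ 2 * E ^ 2) := by gcongr
      _ = _ := by ring

/-- The function `k ↦ u'(b) + k u(b)` is a small Lipschitz perturbation of `2 k`. -/
theorem norm_boundary_sub_le {k l : ℂ} {u u' w w' z z' : ℝ → ℂ} {η : ℝ}
    (h : IsLeftSolution q a k u u') (hl : IsLeftSolution q a l w w')
    (h0 : IsLeftSolution q a 0 z z') (hab : a ≤ b) (hQd : ∀ x, HasDerivAt Q (q x) x)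
    (hQa : Q a = 0) (hQ : ∀ x ∈ Set.Icc a b, ‖Q x‖ ≤ η) (hη0 : 0 ≤ η) (hη1 : η ≤ 1)
    (hk : ‖k‖ ≤ 1) (hl1 : ‖l‖ ≤ 1) :
    ‖(u' b + k * u b) - (w' b + l * w b) - 2 * (k - l)‖ ≤
      Real.exp (3 * (b - a)) ^ 2 * (8 * (b - a) + 3) * (η + ‖k‖ + ‖l‖) * ‖k - l‖ := by
  set E := Real.exp (3 * (b - a)) with hE
  have hL : 0 ≤ b - a := sub_nonneg.2 hab
  have hE1 : 1 ≤ E := Real.one_le_exp (by linarith)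
  have hb : b ∈ Set.Icc a b := Set.right_mem_Icc.2 hab
  have hQ1 : ∀ x ∈ Set.Icc a b, ‖Q x‖ ≤ 1 := fun x hx => (hQ x hx).trans hη1
  have hdiff := h.norm_sub_le hl hQd hQa hQ1 hk hl1
  have hone := h.norm_sub_one_le h0 hQd hQa hQ hη0 hη1 hk b hb
  rw [← hE] at hdiff hone
  have hd : ∀ x, HasDerivAt (fun x => (u' x - Q x * u x) - (w' x - Q x * w x))
      (k ^ 2 * (u x - w x) + (k + l) * (k - l) * w x - Q x * (Q x * (u x - w x)) -
        Q x * ((u' x - Q x * u x) - (w' x - Q x * w x))) x := fun x =>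
    ((h.hasDerivAt_quasi hQd x).2.sub (hl.hasDerivAt_quasi hQd x).2).congr_deriv (by ring)
  set d := ‖k - l‖ with hdd
  have hd0 : 0 ≤ d := norm_nonneg _
  have key := norm_sub_le_of_norm_deriv_le (a := a) (b := b)
    (C := 6 * E ^ 2 * (η + ‖k‖ + ‖l‖) * d) (by positivity) hd (fun x hx => ?_) b hb
  · simp only [h.init_deriv, hl.init_deriv, hQa, zero_mul, sub_zero] at key
    have e1 : (u' b + k * u b) - (w' b + l * w b) - 2 * (k - l) =
        (((u' b - Q b * u b) - (w' b - Q b * w b)) - (k - l)) + Q b * (u b - w b) +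
          (k - l) * (u b - 1) + l * (u b - w b) := by ring
    rw [e1]
    have e2 : ‖Q b * (u b - w b)‖ ≤ η * (3 * E ^ 2 * d) := by
      rw [norm_mul]
      gcongr
      · exact hQ b hb
      · exact (hdiff b hb).1
    have e3 : ‖(k - l) * (u b - 1)‖ ≤ d * (E ^ 2 * (3 * ‖k‖ + 2 * η * (b - a))) := by
      rw [norm_mul]
      gcongr
    have e4 : ‖l * (u b - w b)‖ ≤ ‖l‖ * (3 * E ^ 2 * d) := by
      rw [norm_mul]
      gcongr
      exact (hdiff b hb).1
    refine (norm_add_le _ _).trans ((add_le_add ((norm_add_le _ _).trans (add_le_add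
      ((norm_add_le _ _).trans (add_le_add key e2)) e3)) e4).trans ?_)
    have e5 : 0 ≤ E ^ 2 * d * (2 * (b - a)) * (‖k‖ + ‖l‖) := by positivity
    linarith
  · obtain ⟨e1, e2⟩ := hdiff x hx
    have f1 : ‖k ^ 2 * (u x - w x)‖ ≤ ‖k‖ * (3 * E ^ 2 * d) := by
      rw [norm_mul, norm_pow, sq]
      have : ‖k‖ * ‖k‖ ≤ ‖k‖ := mul_le_of_le_one_left (norm_nonneg _) hk
      gcongr
    have f2 : ‖(k + l) * (k - l) * w x‖ ≤ (‖k‖ + ‖l‖) * d * E ^ 2 := by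
      rw [norm_mul, norm_mul]
      have := hl.norm_le hQd hQa hQ1 hl1 x hx
      gcongr
      · exact norm_add_le _ _
      · rw [← hE] at this
        nlinarith
    have f3 : ‖Q x * (Q x * (u x - w x))‖ ≤ η * (1 * (3 * E ^ 2 * d)) := by
      rw [norm_mul, norm_mul]
      gcongr
      · exact hQ x hx
      · exact hQ1 x hx
    have f4 : ‖Q x * ((u' x - Q x * u x) - (w' x - Q x * w x))‖ ≤ η * (3 * E ^ 2 * d) := by
      rw [norm_mul]
      gcongr
      exact hQ x hx
    have g1 := _root_.norm_sub_le (k ^ 2 * (u x - w x) + (k + l) * (k - l) * w x -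
      Q x * (Q x * (u x - w x))) (Q x * ((u' x - Q x * u x) - (w' x - Q x * w x)))
    have g2 := _root_.norm_sub_le (k ^ 2 * (u x - w x) + (k + l) * (k - l) * w x)
      (Q x * (Q x * (u x - w x)))
    have g3 := norm_add_le (k ^ 2 * (u x - w x)) ((k + l) * (k - l) * w x)
    have g4 : 0 ≤ ‖k‖ * (E ^ 2 * d) := by positivity
    have g5 : 0 ≤ ‖l‖ * (E ^ 2 * d) := by positivity
    linarith

end IsLeftSolution

/-! ### Zeros of small perturbations of `2 k` -/

/-- A function close to `2 k - κ` in the Lipschitz sense has exactly one zero near the origin. -/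
theorem existsUnique_zero_of_lipschitz {D : ℂ → ℂ} {κ : ℂ} {C ε r ρ : ℝ} (hC : 0 ≤ C)
    (hr0 : 0 ≤ r) (hr : C * (ε + 2 * r) ≤ 1) (h0 : ‖D 0 + κ‖ ≤ ρ) (hκ : ‖κ‖ + ρ ≤ r)
    (hD : ∀ k l, ‖k‖ ≤ r → ‖l‖ ≤ r →
      ‖D k - D l - 2 * (k - l)‖ ≤ C * (ε + ‖k‖ + ‖l‖) * ‖k - l‖) :
    ∃ k, ‖k‖ ≤ r ∧ D k = 0 ∧ (∀ l, ‖l‖ ≤ r → D l = 0 → l = k) ∧ ‖k‖ ≤ ‖κ‖ + ρ ∧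
      ‖k - κ / 2‖ ≤ C * (ε + ‖k‖) * ‖k‖ + ρ := by
  let T : ℂ → ℂ := fun k => k - D k / 2
  have hT : ∀ k l, ‖k‖ ≤ r → ‖l‖ ≤ r → ‖T k - T l‖ ≤ 1 / 2 * ‖k - l‖ := fun k l hk hl => by
    have e1 : T k - T l = -(D k - D l - 2 * (k - l)) / 2 := by simp only [T]; ring
    rw [e1, norm_div, norm_neg, Complex.norm_ofNat]
    have e2 : C * (ε + ‖k‖ + ‖l‖) * ‖k - l‖ ≤ 1 * ‖k - l‖ := by
      gcongr
      exact (mul_le_mul_of_nonneg_left (by linarith) hC).trans hr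
    have := hD k l hk hl
    linarith
  have hD0 : ‖D 0‖ ≤ ‖κ‖ + ρ := by
    have := norm_sub_le (D 0 + κ) κ
    rw [add_sub_cancel_right] at this
    linarith
  have hT0 : ‖T 0‖ ≤ (‖κ‖ + ρ) / 2 := by
    simp only [T, zero_sub, norm_neg, norm_div, Complex.norm_ofNat]
    linarith
  have hzero : ‖(0 : ℂ)‖ ≤ r := by simpa using hr0
  have hmaps : Set.MapsTo T (Metric.closedBall 0 r) (Metric.closedBall 0 r) := fun k hk => by
    rw [mem_closedBall_zero_iff] at hk ⊢
    have e1 := hT k 0 hk hzero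
    rw [sub_zero] at e1
    have e2 := norm_add_le (T k - T 0) (T 0)
    rw [sub_add_cancel] at e2
    linarith
  have hcontr : ContractingWith (1 / 2) (hmaps.restrict T _ _) := by
    refine ⟨by norm_num, LipschitzWith.of_dist_le_mul fun k l => ?_⟩
    have := hT k l (mem_closedBall_zero_iff.1 k.2) (mem_closedBall_zero_iff.1 l.2)
    rw [Subtype.dist_eq, Subtype.dist_eq, dist_eq_norm, dist_eq_norm]
    simpa using this
  obtain ⟨k, hk, hfix, -⟩ := hcontr.exists_fixedPoint' Metric.isClosed_closedBall.isComplete hmaps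
    (x := 0) (by simpa using hr0) (edist_ne_top _ _)
  rw [mem_closedBall_zero_iff] at hk
  have hDk : D k = 0 := by
    have : k - D k / 2 = k := hfix
    simpa using this
  have hkb : ‖k‖ ≤ ‖κ‖ + ρ := by
    have e1 := hT k 0 hk hzero
    rw [sub_zero, show T k = k from hfix] at e1
    have e2 := norm_add_le (k - T 0) (T 0)
    rw [sub_add_cancel] at e2
    linarith
  refine ⟨k, hk, hDk, fun l hl hDl => ?_, hkb, ?_⟩
  · have e1 := hT l k hl hk
    have e2 : T l - T k = l - k := by simp [T, hDl, hDk]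
    rw [e2] at e1
    have e3 := norm_nonneg (l - k)
    exact sub_eq_zero.1 (norm_le_zero_iff.1 (by linarith))
  · have e1 := hD k 0 hk hzero
    rw [hDk, sub_zero, norm_zero, add_zero] at e1
    have e2 : k - κ / 2 = -((0 - D 0 - 2 * k) + (D 0 + κ)) / 2 := by ring
    rw [e2, norm_div, norm_neg, Complex.norm_ofNat]
    have e3 := norm_add_le (0 - D 0 - 2 * k) (D 0 + κ)
    have e4 := norm_nonneg ((0 - D 0 - 2 * k) + (D 0 + κ))
    linarith

/-! ### Square integrable solutions for a compactly supported potential -/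

theorem Convex.eq_of_hasDerivAt_zero {g : ℝ → ℂ} {S : Set ℝ} (hS : Convex ℝ S)
    (hg : ∀ x ∈ S, HasDerivAt g 0 x) {x y : ℝ} (hx : x ∈ S) (hy : y ∈ S) : g x = g y := by
  have := hS.norm_image_sub_le_of_norm_hasDerivWithin_le (f := g) (f' := fun _ => 0) (C := 0)
    (fun z hz => (hg z hz).hasDerivWithinAt) (by simp) hy hx
  rw [zero_mul, norm_le_zero_iff, sub_eq_zero] at this
  exact this

theorem hasDerivAt_cexp_mul (κ : ℂ) (x : ℝ) :
    HasDerivAt (fun x : ℝ => Complex.exp (κ * x)) (κ * Complex.exp (κ * x)) x := by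
  have := ((Complex.ofRealCLM.hasDerivAt (x := x)).const_mul κ).cexp
  simpa [mul_comm] using this

/-- On a convex set where `f'' = κ² f`, the function `f' - κ f` is a multiple of `e^{-κ x}`. -/
theorem sub_mul_cexp_eq {f f' : ℝ → ℂ} {κ : ℂ} {S : Set ℝ} (hS : Convex ℝ S)
    (hf : ∀ x, HasDerivAt f (f' x) x) (hf' : ∀ x ∈ S, HasDerivAt f' (κ ^ 2 * f x) x)
    {x y : ℝ} (hx : x ∈ S) (hy : y ∈ S) :
    (f' x - κ * f x) * Complex.exp (κ * x) = (f' y - κ * f y) * Complex.exp (κ * y) := by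
  refine hS.eq_of_hasDerivAt_zero (g := fun x => (f' x - κ * f x) * Complex.exp (κ * x))
    (fun z hz => ?_) hx hy
  refine (((hf' z hz).sub ((hf z).const_mul κ)).mul (hasDerivAt_cexp_mul κ z)).congr_deriv ?_
  simp only [Pi.sub_apply]
  ring

theorem eq_mul_cexp {f f' : ℝ → ℂ} {κ : ℂ} {S : Set ℝ} (hS : Convex ℝ S)
    (hf : ∀ x, HasDerivAt f (f' x) x) (hf' : ∀ x ∈ S, f' x = κ * f x)
    {x y : ℝ} (hx : x ∈ S) (hy : y ∈ S) : f x = f y * Complex.exp (κ * (x - y)) := by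
  have h1 := hS.eq_of_hasDerivAt_zero (g := fun x => f x * Complex.exp (-κ * x))
    (fun z hz => ((hf z).mul (hasDerivAt_cexp_mul (-κ) z)).congr_deriv (by rw [hf' z hz]; ring))
    hx hy
  have e : Complex.exp (κ * (x - y)) = Complex.exp (κ * x) * Complex.exp (-κ * y) := by
    rw [← Complex.exp_add]; ring_nf
  have e' : Complex.exp (-κ * x) * Complex.exp (κ * x) = 1 := by
    rw [← Complex.exp_add]; simp
  rw [e]
  linear_combination (-f x) * e' + Complex.exp (κ * x) * h1

theorem nonpos_of_le_norm_of_memLp {f : ℝ → ℂ} (hf : MemLp f 2 volume) {S : Set ℝ}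
    (hSm : MeasurableSet S) (hS : volume S = ⊤) {m : ℝ} (hm : ∀ x ∈ S, m ≤ ‖f x‖) : m ≤ 0 := by
  by_contra! h
  have h1 : MemLp (fun _ : ℝ => m) 2 (volume.restrict S) := by
    refine (hf.restrict S).mono aestronglyMeasurable_const ?_
    refine (ae_restrict_iff' hSm).2 (Eventually.of_forall fun x hx => ?_)
    rw [Real.norm_of_nonneg h.le]
    exact hm x hx
  rw [memLp_const_iff (by simp) (by simp), Measure.restrict_apply_univ, hS] at h1
  simp [h.ne'] at h1

/-- A square integrable solution of `f'' = κ² f` on a half-line on which `e^{-κ x}` does not decay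
satisfies `f' = κ f` there. -/
theorem deriv_eq_mul_of_memLp {f f' : ℝ → ℂ} {κ : ℂ} {S : Set ℝ} (hS : Convex ℝ S)
    (hSm : MeasurableSet S) (hSv : volume S = ⊤) {B : ℝ} (hB : ∀ x ∈ S, κ.re * x ≤ B)
    (hf : ∀ x, HasDerivAt f (f' x) x) (hf' : ∀ x ∈ S, HasDerivAt f' (κ ^ 2 * f x) x)
    (hL : MemLp f 2 volume) (hL' : MemLp f' 2 volume) : ∀ x ∈ S, f' x = κ * f x := by
  intro y hy
  set c := (f' y - κ * f y) * Complex.exp (κ * y) with hc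
  have h1 : ‖c‖ * Real.exp (-B) ≤ 0 := by
    refine nonpos_of_le_norm_of_memLp (hL'.sub (hL.const_mul κ)) hSm hSv fun x hx => ?_
    have h2 := sub_mul_cexp_eq hS hf hf' hx hy
    rw [← hc] at h2
    rw [← h2, norm_mul, Complex.norm_exp, mul_assoc, ← Real.exp_add]
    refine mul_le_of_le_one_right (norm_nonneg _) ?_
    rw [Real.exp_le_one_iff]
    have : (κ * (x : ℂ)).re = κ.re * x := by simp
    have := hB x hx
    linarith
  have h3 : ‖c‖ = 0 := by
    have := Real.exp_pos (-B)
    nlinarith [norm_nonneg c]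
  rw [norm_eq_zero, hc, mul_eq_zero, or_iff_left (Complex.exp_ne_zero _), sub_eq_zero] at h3
  exact h3

/-- A square integrable solution of `f'' = (q + k²) f` is proportional to the left solution, and
the latter satisfies the boundary condition `u'(b) + k u(b) = 0`. -/
theorem eq_left_solution_of_memLp {q : ℝ → ℂ} {a b K : ℝ} (ha : ∀ x, x ≤ a → q x = 0)
    (hb : ∀ x, b ≤ x → q x = 0) (hK : ∀ x, ‖q x‖ ≤ K) {k : ℂ} (hk : 0 ≤ k.re)
    {f f' : ℝ → ℂ} (hf : ∀ x, HasDerivAt f (f' x) x)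
    (hf' : ∀ x, HasDerivAt f' ((q x + k ^ 2) * f x) x) (hL : MemLp f 2 volume)
    (hL' : MemLp f' 2 volume) {u u' : ℝ → ℂ} (hu : IsLeftSolution q a k u u') :
    (f = fun x => f a * u x) ∧ (f ≠ 0 → 0 < k.re ∧ u' b + k * u b = 0) := by
  have hKp : ∀ x, ‖q x + k ^ 2‖ ≤ K + ‖k ^ 2‖ := fun x =>
    (norm_add_le _ _).trans (add_le_add (hK x) le_rfl)
  have hleft := deriv_eq_mul_of_memLp (convex_Iic a) measurableSet_Iic Real.volume_Iic
    (B := k.re * a) (fun x hx => mul_le_mul_of_nonneg_left hx hk) hf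
    (fun x hx => by simpa [ha x hx] using hf' x) hL hL'
  have hright := deriv_eq_mul_of_memLp (κ := -k) (convex_Ici b) measurableSet_Ici Real.volume_Ici
    (B := -k.re * b) (fun x hx => by
      have : k.re * b ≤ k.re * x := mul_le_mul_of_nonneg_left hx hk
      simp only [Complex.neg_re]
      linarith) hf (fun x hx => by simpa [hb x hx] using hf' x) hL hL'
  have hzero := eq_zero_of_second_order hKp (u := fun x => f x - f a * u x)
    (u' := fun x => f' x - f a * u' x) (a := a)
    (fun x => (hf x).sub ((hu.hasDerivAt x).const_mul _))
    (fun x => ((hf' x).sub ((hu.hasDerivAt_deriv x).const_mul _)).congr_deriv (by ring))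
    (by simp [hu.init]) (by rw [hu.init_deriv, hleft a Set.self_mem_Iic]; ring)
  have heq : f = fun x => f a * u x := by
    funext x
    exact sub_eq_zero.1 (congrFun hzero x)
  refine ⟨heq, fun hne => ?_⟩
  have hfa : f a ≠ 0 := fun h => hne (by rw [heq, h]; funext x; simp)
  constructor
  · refine lt_of_le_of_ne hk fun h0 => hfa ?_
    have : ‖f a‖ ≤ 0 := by
      refine nonpos_of_le_norm_of_memLp hL measurableSet_Iic (Real.volume_Iic (a := a))
        fun x hx => ?_
      rw [eq_mul_cexp (convex_Iic a) hf hleft hx Set.self_mem_Iic, norm_mul, Complex.norm_exp]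
      simp [← h0]
    exact norm_le_zero_iff.1 this
  · have h1 := hright b Set.self_mem_Ici
    have h2 : f' b = f a * u' b := by
      have h3 := hf b
      rw [heq] at h3
      exact h3.unique ((hu.hasDerivAt b).const_mul _)
    rw [h2, congrFun heq b] at h1
    have h4 : f a * (u' b + k * u b) = 0 := by linear_combination h1
    exact (mul_eq_zero.1 h4).resolve_left hfa

/-- Integral of the square of a function which is exponential outside `[a, b]`. -/
theorem integrable_sq_of_exp_tails {f : ℝ → ℂ} (hf : Continuous f) {a b : ℝ} (hab : a ≤ b) {k : ℂ}
    (hk : 0 < k.re) (hl : ∀ x, x ≤ a → f x = f a * Complex.exp (k * (x - a)))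
    (hr : ∀ x, b ≤ x → f x = f b * Complex.exp (-k * (x - b))) :
    Integrable (fun x => f x ^ 2) ∧
      ∫ x, f x ^ 2 = f a ^ 2 / (2 * k) + (∫ x in a..b, f x ^ 2) + f b ^ 2 / (2 * k) := by
  have hk0 : k ≠ 0 := fun h => by simp [h] at hk
  have hA : (0 : ℝ) < (2 * k).re := by simpa using hk
  have hB : (-(2 * k)).re < 0 := by simpa using hk
  have el : Set.EqOn (fun x => f x ^ 2)
      (fun x : ℝ => (f a ^ 2 * Complex.exp (-(2 * k) * a)) * Complex.exp (2 * k * x))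
      (Set.Iic a) := fun x hx => by
    simp only
    rw [hl x hx, mul_pow, ← Complex.exp_nat_mul, mul_assoc, ← Complex.exp_add]
    congr 2
    push_cast
    ring
  have er : Set.EqOn (fun x => f x ^ 2)
      (fun x : ℝ => (f b ^ 2 * Complex.exp (2 * k * b)) * Complex.exp (-(2 * k) * x))
      (Set.Ioi b) := fun x hx => by
    simp only
    rw [hr x (le_of_lt hx), mul_pow, ← Complex.exp_nat_mul, mul_assoc, ← Complex.exp_add]
    congr 2
    push_cast
    ring
  have i1 : IntegrableOn (fun x => f x ^ 2) (Set.Iic a) :=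
    IntegrableOn.congr_fun ((integrableOn_exp_mul_complex_Iic hA a).const_mul _) el.symm
      measurableSet_Iic
  have i3 : IntegrableOn (fun x => f x ^ 2) (Set.Ioi b) :=
    IntegrableOn.congr_fun ((integrableOn_exp_mul_complex_Ioi hB b).const_mul _) er.symm
      measurableSet_Ioi
  have i2 : IntegrableOn (fun x => f x ^ 2) (Set.Ioc a b) :=
    ((hf.pow 2).intervalIntegrable a b).1
  have i23 : IntegrableOn (fun x => f x ^ 2) (Set.Ioi a) := by
    rw [← Set.Ioc_union_Ioi_eq_Ioi hab]
    exact i2.union i3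
  have i : Integrable (fun x => f x ^ 2) := by
    rw [← integrableOn_univ, ← Set.Iic_union_Ioi (a := a)]
    exact i1.union i23
  refine ⟨i, ?_⟩
  rw [← intervalIntegral.integral_Iic_add_Ioi i1 i23, ← Set.Ioc_union_Ioi_eq_Ioi hab,
    setIntegral_union (Set.Ioc_disjoint_Ioi le_rfl) measurableSet_Ioi i2 i3,
    setIntegral_congr_fun measurableSet_Iic el, setIntegral_congr_fun measurableSet_Ioi er,
    intervalIntegral.integral_of_le hab]
  have e1 := integral_exp_mul_complex_Iic hA a
  have e2 := integral_exp_mul_complex_Ioi hB b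
  have e3 : Complex.exp (-(2 * k) * a) * Complex.exp (2 * k * a) = 1 := by
    rw [← Complex.exp_add]; simp
  have e4 : Complex.exp (2 * k * b) * Complex.exp (-(2 * k) * b) = 1 := by
    rw [← Complex.exp_add]; simp
  rw [integral_const_mul, integral_const_mul, e1, e2]
  simp only [neg_mul] at e3 e4 ⊢
  field_simp
  linear_combination f a ^ 2 * e3 + f b ^ 2 * e4

theorem memLp_two_of_integrable_sq {f : ℝ → ℂ} (hf : Continuous f)
    (h : Integrable fun x => f x ^ 2) : MemLp f 2 volume := by
  rw [memLp_two_iff_integrable_sq_norm hf.aestronglyMeasurable]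
  simpa [norm_pow] using h.norm

namespace IsLeftSolution

variable {q : ℝ → ℂ} {a b : ℝ} {k : ℂ} {u u' : ℝ → ℂ}

theorem continuous (h : IsLeftSolution q a k u u') : Continuous u :=
  continuous_iff_continuousAt.2 fun x => (h.hasDerivAt x).continuousAt

theorem continuous_deriv (h : IsLeftSolution q a k u u') : Continuous u' :=
  continuous_iff_continuousAt.2 fun x => (h.hasDerivAt_deriv x).continuousAt

theorem deriv_eq_left (h : IsLeftSolution q a k u u') (ha : ∀ x, x ≤ a → q x = 0) :
    ∀ x ∈ Set.Iic a, u' x = k * u x := fun x hx => by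
  have h1 := sub_mul_cexp_eq (convex_Iic a) h.hasDerivAt
    (fun x hx => by simpa [ha x hx] using h.hasDerivAt_deriv x) hx Set.self_mem_Iic
  rw [h.init, h.init_deriv, mul_one, sub_self, zero_mul, mul_eq_zero,
    or_iff_left (Complex.exp_ne_zero _), sub_eq_zero] at h1
  exact h1

theorem deriv_eq_right (h : IsLeftSolution q a k u u') (hb : ∀ x, b ≤ x → q x = 0)
    (hD : u' b + k * u b = 0) : ∀ x ∈ Set.Ici b, u' x = -k * u x := fun x hx => by
  have h1 := sub_mul_cexp_eq (κ := -k) (convex_Ici b) h.hasDerivAt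
    (fun x hx => by simpa [hb x hx] using h.hasDerivAt_deriv x) hx Set.self_mem_Ici
  have h2 : u' b - -k * u b = 0 := by linear_combination hD
  rw [h2, zero_mul, mul_eq_zero, or_iff_left (Complex.exp_ne_zero _), sub_eq_zero] at h1
  exact h1

theorem integral_sq (h : IsLeftSolution q a k u u') (hab : a ≤ b) (ha : ∀ x, x ≤ a → q x = 0)
    (hb : ∀ x, b ≤ x → q x = 0) (hk : 0 < k.re) (hD : u' b + k * u b = 0) :
    Integrable (fun x => u x ^ 2) ∧
      ∫ x, u x ^ 2 = 1 / (2 * k) + (∫ x in a..b, u x ^ 2) + u b ^ 2 / (2 * k) := by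
  have := integrable_sq_of_exp_tails h.continuous hab hk
    (fun x hx => eq_mul_cexp (convex_Iic a) h.hasDerivAt (h.deriv_eq_left ha) hx Set.self_mem_Iic)
    (fun x hx => eq_mul_cexp (convex_Ici b) h.hasDerivAt (h.deriv_eq_right hb hD) hx
      Set.self_mem_Ici)
  rwa [h.init, one_pow] at this

theorem memLp (h : IsLeftSolution q a k u u') (hab : a ≤ b) (ha : ∀ x, x ≤ a → q x = 0)
    (hb : ∀ x, b ≤ x → q x = 0) (hk : 0 < k.re) (hD : u' b + k * u b = 0) :
    MemLp u 2 volume ∧ MemLp u' 2 volume := by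
  refine ⟨memLp_two_of_integrable_sq h.continuous (h.integral_sq hab ha hb hk hD).1,
    memLp_two_of_integrable_sq h.continuous_deriv
      (integrable_sq_of_exp_tails h.continuous_deriv hab hk (fun x hx => ?_) fun x hx => ?_).1⟩
  · rw [h.deriv_eq_left ha x hx, h.deriv_eq_left ha a Set.self_mem_Iic, mul_assoc,
      ← eq_mul_cexp (convex_Iic a) h.hasDerivAt (h.deriv_eq_left ha) hx Set.self_mem_Iic]
  · rw [h.deriv_eq_right hb hD x hx, h.deriv_eq_right hb hD b Set.self_mem_Ici, mul_assoc,
      ← eq_mul_cexp (convex_Ici b) h.hasDerivAt (h.deriv_eq_right hb hD) hx Set.self_mem_Ici]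

end IsLeftSolution

theorem exists_isLeftSolution {q : ℝ → ℂ} (hq : Continuous q) {K : ℝ} (hK : ∀ x, ‖q x‖ ≤ K) (a : ℝ)
    (k : ℂ) : ∃ u u', IsLeftSolution q a k u u' := by
  obtain ⟨u, u', h1, h2, h3, h4⟩ := exists_hasDerivAt_second_order
    (hq.add (continuous_const (y := k ^ 2))) (K := K + ‖k ^ 2‖)
    (fun x => (norm_add_le _ _).trans (add_le_add (hK x) le_rfl)) a 1 k
  exact ⟨u, u', h1, h2, h3, h4⟩

/-- Solvability condition: if `w'' = p w - c φ` and `φ'' = p φ` with square integrable `w`, `w'`,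
`φ`, `φ'`, then integrating the derivative of the Wronskian gives `c ∫ φ² = 0`. -/
theorem mul_integral_sq_eq_zero {p w w' φ φ' : ℝ → ℂ} {c : ℂ}
    (hw : ∀ x, HasDerivAt w (w' x) x) (hw' : ∀ x, HasDerivAt w' (p x * w x - c * φ x) x)
    (hφ : ∀ x, HasDerivAt φ (φ' x) x) (hφ' : ∀ x, HasDerivAt φ' (p x * φ x) x)
    (hwL : MemLp w 2 volume) (hwL' : MemLp w' 2 volume) (hφL : MemLp φ 2 volume)
    (hφL' : MemLp φ' 2 volume) : c * ∫ x, φ x ^ 2 = 0 := by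
  have h1 : Integrable fun x => φ x ^ 2 :=
    (hφL.integrable_mul hφL).congr (Eventually.of_forall fun x => (sq (φ x)).symm)
  have h2 := integral_eq_zero_of_hasDerivAt_of_integrable
    (f := fun x => w' x * φ x - w x * φ' x) (f' := fun x => -c * φ x ^ 2)
    (fun x => (((hw' x).mul (hφ x)).sub ((hw x).mul (hφ' x))).congr_deriv (by ring))
    (h1.const_mul _) ((hwL'.integrable_mul hφL).sub (hwL.integrable_mul hφL'))
  rw [integral_const_mul] at h2
  linear_combination -h2

/-! ### Eigenvalues as zeros of the boundary value function -/

section Eigenvalue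

variable {V : ℝ → ℝ → ℂ} (hV : IsOscillatingPotential V) {ε : ℝ}

theorem IsOscillatingPotential.continuous_comp (hV : IsOscillatingPotential V) (ε : ℝ) :
    Continuous fun x => V x (x / ε) :=
  hV.smooth.continuous.comp (continuous_id.prodMk (continuous_id.div_const ε))

theorem schrodingerOp_apply_ae (v : (schrodingerOp hV ε).domain) :
    ∃ v' v'' : L2R, HasWeakDeriv v v' ∧ HasWeakDeriv v' v'' ∧
      schrodingerOp hV ε v =ᵐ[volume] fun x => -v'' x + V x (x / ε) * (v : L2R) x := by
  obtain ⟨v', h1, h2⟩ := weakSecondDeriv_spec v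
  refine ⟨v', _, h1, h2, ?_⟩
  have e : schrodingerOp hV ε v =
      -weakSecondDeriv v + (hV.memLp_top ε).toLp _ • (v : L2R) := rfl
  rw [e]
  filter_upwards [Lp.coeFn_add (-weakSecondDeriv v) ((hV.memLp_top ε).toLp _ • (v : L2R)),
    Lp.coeFn_neg (weakSecondDeriv v),
    Lp.coeFn_lpSMul (r := 2) ((hV.memLp_top ε).toLp _) (v : L2R),
    (hV.memLp_top ε).coeFn_toLp] with x e1 e2 e3 e4
  rw [e1, Pi.add_apply, e2, Pi.neg_apply, e3, Pi.smul_apply', e4, smul_eq_mul]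

/-- A solution in the domain of `(H_ε - μ) v = c φ` with continuous `φ` has a classical
representative. -/
theorem exists_classical_of_schrodingerOp {μ c : ℂ} (v : (schrodingerOp hV ε).domain) {φ : ℝ → ℂ}
    (hφ : Continuous φ)
    (heq : schrodingerOp hV ε v - μ • (v : L2R) =ᵐ[volume] fun x => c * φ x) :
    ∃ f f' : ℝ → ℂ, (v : L2R) =ᵐ[volume] f ∧ (∀ x, HasDerivAt f (f' x) x) ∧
      (∀ x, HasDerivAt f' ((V x (x / ε) - μ) * f x - c * φ x) x) ∧ MemLp f 2 volume ∧
      MemLp f' 2 volume := by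
  obtain ⟨v', v'', h1, h2, h3⟩ := schrodingerOp_apply_ae hV v
  have hq := hV.continuous_comp ε
  obtain ⟨f, f', e1, e2, e3, e4⟩ := h1.exists_classical h2 (p := fun x => V x (x / ε) - μ)
    (r := fun x => -(c * φ x)) (hq.sub continuous_const) (continuous_const.mul hφ).neg (by
      filter_upwards [h3, heq, Lp.coeFn_sub (schrodingerOp hV ε v) (μ • (v : L2R)),
        Lp.coeFn_smul μ (v : L2R)] with x g1 g2 g3 g4
      rw [g3, Pi.sub_apply, g1, g4, Pi.smul_apply, smul_eq_mul] at g2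
      linear_combination -g2)
  refine ⟨f, f', e1, e3, fun x => (e4 x).congr_deriv (by ring), (Lp.memLp _).ae_eq e1,
    (Lp.memLp _).ae_eq e2⟩

/-- A classical square integrable solution of `f'' = (V(x, x/ε) - μ) f` lies in the domain of
`H_ε` and solves `H_ε f = μ f`. -/
theorem exists_schrodingerOp_eq_smul {μ : ℂ} {K : ℝ} (hK : ∀ x, ‖V x (x / ε)‖ ≤ K) {f f' : ℝ → ℂ}
    (hf : ∀ x, HasDerivAt f (f' x) x) (hf' : ∀ x, HasDerivAt f' ((V x (x / ε) - μ) * f x) x)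
    (hL : MemLp f 2 volume) (hL' : MemLp f' 2 volume) :
    ∃ v : (schrodingerOp hV ε).domain, (v : L2R) = hL.toLp f ∧
      schrodingerOp hV ε v = μ • (v : L2R) := by
  have hq := hV.continuous_comp ε
  have hL'' : MemLp (fun x => (V x (x / ε) - μ) * f x) 2 volume := by
    refine hL.of_le_mul (c := K + ‖μ‖)
      ((hq.sub continuous_const).aestronglyMeasurable.mul hL.1) (Eventually.of_forall fun x => ?_)
    rw [norm_mul]
    gcongr
    exact (norm_sub_le _ _).trans (add_le_add (hK x) le_rfl)
  have w1 := hasWeakDeriv_of_hasDerivAt hf hL hL'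
  have w2 := hasWeakDeriv_of_hasDerivAt hf' hL' hL''
  let v : (schrodingerOp hV ε).domain := ⟨hL.toLp f, ⟨_, _, w1, w2⟩⟩
  refine ⟨v, rfl, ?_⟩
  obtain ⟨v', v'', h1, h2, h3⟩ := schrodingerOp_apply_ae hV v
  obtain rfl : hL'.toLp f' = v' := w1.unique h1
  obtain rfl := w2.unique h2
  apply Lp.ext
  filter_upwards [h3, hL.coeFn_toLp, hL''.coeFn_toLp, Lp.coeFn_smul μ (v : L2R)] with x g1 g2 g3 g4
  rw [g1, g4, Pi.smul_apply, smul_eq_mul, g3]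
  change -_ + _ * (hL.toLp f) x = μ * (hL.toLp f) x
  rw [g2]
  ring

variable {a b K : ℝ}

/-- An eigenvalue `-k²` with `0 ≤ Re k` yields a zero of `k ↦ u'(b) + k u(b)` with `0 < Re k`. -/
theorem boundary_eq_zero_of_isEigenvalue (ha : ∀ x ξ, x ≤ a → V x ξ = 0)
    (hb : ∀ x ξ, b ≤ x → V x ξ = 0) (hK : ∀ x ξ, ‖V x ξ‖ ≤ K) {k : ℂ} (hk : 0 ≤ k.re)
    {u u' : ℝ → ℂ} (hu : IsLeftSolution (fun x => V x (x / ε)) a k u u')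
    (he : IsEigenvalue (schrodingerOp hV ε) (-k ^ 2)) : 0 < k.re ∧ u' b + k * u b = 0 := by
  obtain ⟨v, hv0, hv⟩ := he
  obtain ⟨f, f', e1, e2, e3, e4, e5⟩ := exists_classical_of_schrodingerOp hV (c := 0)
    (φ := fun _ => 0) v continuous_const (μ := -k ^ 2) (by
      rw [hv, sub_self]
      filter_upwards [Lp.coeFn_zero ℂ 2 (volume : Measure ℝ)] with x hx
      rw [zero_mul]
      exact hx)
  refine (eq_left_solution_of_memLp (K := K) (fun x hx => ha x _ hx) (fun x hx => hb x _ hx)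
    (fun x => hK x _) hk e2 (fun x => (e3 x).congr_deriv (by ring)) e4 e5 hu).2 fun hf => hv0 ?_
  apply Subtype.ext
  apply Lp.ext
  filter_upwards [e1, Lp.coeFn_zero ℂ 2 (volume : Measure ℝ)] with x hx hx0
  rw [hx, hf]
  exact hx0.symm

/-- A zero `k` of `k ↦ u'(b) + k u(b)` with `0 < Re k` yields the eigenvalue `-k²`, which is simple
as soon as `∫ u² ≠ 0`. -/
theorem isSimpleEigenvalue_of_boundary_eq_zero (hab : a ≤ b) (ha : ∀ x ξ, x ≤ a → V x ξ = 0)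
    (hb : ∀ x ξ, b ≤ x → V x ξ = 0) (hK : ∀ x ξ, ‖V x ξ‖ ≤ K) {k : ℂ} (hk : 0 < k.re)
    {u u' : ℝ → ℂ} (hu : IsLeftSolution (fun x => V x (x / ε)) a k u u')
    (hD : u' b + k * u b = 0) (hI : ∫ x, u x ^ 2 ≠ 0) :
    IsSimpleEigenvalue (schrodingerOp hV ε) (-k ^ 2) := by
  obtain ⟨hL, hL'⟩ := hu.memLp hab (fun x hx => ha x _ hx) (fun x hx => hb x _ hx) hk hD
  have hu2 : ∀ x, HasDerivAt u' ((V x (x / ε) - -k ^ 2) * u x) x := fun x =>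
    (hu.hasDerivAt_deriv x).congr_deriv (by ring)
  obtain ⟨v, hv, hvT⟩ := exists_schrodingerOp_eq_smul hV (fun x => hK x _) hu.hasDerivAt hu2 hL hL'
  set φ : L2R := hL.toLp u with hφ
  have hφ0 : φ ≠ 0 := fun h => hI (by
    have h1 : u =ᵐ[volume] 0 := by
      filter_upwards [hL.coeFn_toLp, Lp.coeFn_zero ℂ 2 (volume : Measure ℝ)] with x h1 h2
      rw [← h1, ← hφ, h, h2]
    rw [integral_congr_ae (g := fun _ => 0) (h1.mono fun x hx => by simp [hx]), integral_zero])
  have hv0 : v ≠ 0 := fun h => hφ0 (by rw [← hv, h]; rfl)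
  refine ⟨⟨v, hv0, hvT⟩, ?_⟩
  -- `(H_ε + k²) w = c φ` is solvable only for `c = 0`, and then `w` is a multiple of `φ`
  have key : ∀ (w : (schrodingerOp hV ε).domain) (c : ℂ),
      schrodingerOp hV ε w - (-k ^ 2 : ℂ) • (w : L2R) = c • φ →
      (w : L2R) ∈ Submodule.span ℂ {φ} := by
    intro w c hw
    obtain ⟨f, f', e1, e2, e3, e4, e5⟩ := exists_classical_of_schrodingerOp hV (c := c) w
      hu.continuous (μ := -k ^ 2) (by
        rw [hw]
        filter_upwards [Lp.coeFn_smul c φ, hL.coeFn_toLp] with x h1 h2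
        rw [h1, Pi.smul_apply, smul_eq_mul, h2])
    have hc : c = 0 := (mul_eq_zero.1 (mul_integral_sq_eq_zero e2 e3 hu.hasDerivAt hu2 e4 e5 hL
      hL')).resolve_right hI
    have hf := (eq_left_solution_of_memLp (K := K) (fun x hx => ha x _ hx) (fun x hx => hb x _ hx)
      (fun x => hK x _) hk.le e2 (fun x => (e3 x).congr_deriv (by rw [hc]; ring)) e4 e5 hu).1
    refine Submodule.mem_span_singleton.2 ⟨f a, ?_⟩
    apply Lp.ext
    filter_upwards [e1, Lp.coeFn_smul (f a) φ, hL.coeFn_toLp] with x h1 h2 h3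
    rw [h1, h2, Pi.smul_apply, smul_eq_mul, h3]
    exact (congrFun hf x).symm
  have hroot : rootSubspace (schrodingerOp hV ε) (-k ^ 2) = Submodule.span ℂ {φ} := by
    apply le_antisymm
    · refine iSup_le fun n => ?_
      induction n with
      | zero => exact bot_le
      | succ n ih =>
        rintro w ⟨hw, hw'⟩
        obtain ⟨c, hc⟩ := Submodule.mem_span_singleton.1 (ih hw')
        exact key ⟨w, hw⟩ c hc.symm
    · rw [Submodule.span_singleton_le_iff_mem]
      refine Submodule.mem_iSup_of_mem 1 ⟨hv ▸ v.2, ?_⟩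
      have : schrodingerOp hV ε ⟨φ, hv ▸ v.2⟩ = (-k ^ 2 : ℂ) • φ := by
        have h1 : (⟨φ, hv ▸ v.2⟩ : (schrodingerOp hV ε).domain) = v := Subtype.ext hv.symm
        rw [h1, hvT, hv]
      rw [this, sub_self]
      exact Submodule.zero_mem _
  rw [hroot, Module.rank_eq_one_iff_finrank_eq_one]
  exact finrank_span_singleton hφ0

end Eigenvalue

/-! ### Asymptotics of the zero and the eigenvalue -/

theorem Complex.exists_sq_eq_re_nonneg (z : ℂ) : ∃ k : ℂ, k ^ 2 = z ∧ 0 ≤ k.re := by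
  obtain ⟨k, hk⟩ := IsAlgClosed.exists_pow_nat_eq z two_pos
  rcases le_total 0 k.re with h | h
  · exact ⟨k, hk, h⟩
  · exact ⟨-k, by rw [neg_sq, hk], by simpa using h⟩

/-- The zeros near the origin of the boundary value function `k ↦ u'(b) + k u(b)` of the potential
`V(x, x/ε)`: for small `ε` there is exactly one in a fixed disk, and it is `k₂ ε² + O(ε³)`. -/
theorem IsOscillatingPotential.exists_boundary_zero {V : ℝ → ℝ → ℂ} (hV : IsOscillatingPotential V)
    (hmean : ∀ x : ℝ, ∫ ξ in (0 : ℝ)..1, V x ξ = 0) :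
    ∃ (a b K : ℝ) (u u' : ℝ → ℂ → ℝ → ℂ) (r C : ℝ), a < b ∧ (∀ x ξ, x ≤ a → V x ξ = 0) ∧
      (∀ x ξ, b ≤ x → V x ξ = 0) ∧ (∀ x ξ, ‖V x ξ‖ ≤ K) ∧
      (∀ ε k, IsLeftSolution (fun x => V x (x / ε)) a k (u ε k) (u' ε k)) ∧ 0 < r ∧ 0 ≤ C ∧
      ∀ᶠ ε in 𝓝[>] (0 : ℝ), ∃ k : ℂ, u' ε k b + k * u ε k b = 0 ∧
        (∀ l : ℂ, ‖l‖ ≤ r → u' ε l b + l * u ε l b = 0 → l = k) ∧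
        ‖k - ε ^ 2 * kTwo V‖ ≤ C * ε ^ 3 ∧ ∀ x ∈ Set.Icc a b, ‖u ε k x - 1‖ ≤ C * ε := by
  obtain ⟨a, b, M, hab, hM, ha, hb, hK, hbounds⟩ := hV.exists_primitive_bounds hmean
  choose u u' hu using fun (ε : ℝ) (k : ℂ) =>
    exists_isLeftSolution (hV.continuous_comp ε) (fun x => hK x (x / ε)) a k
  set L := b - a with hL
  have hL0 : 0 < L := sub_pos.2 hab
  set E := Real.exp (3 * L) with hE
  have hE0 : 0 < E := Real.exp_pos _
  -- `c` is the Lipschitz constant, `c₀ ε³` bounds the error at `k = 0`, `c₁ ε²` bounds the zero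
  set c := E ^ 2 * (8 * L + 3) with hc
  have hc0 : 0 < c := by positivity
  set c₀ := M ^ 3 * (E ^ 2 * (2 * L + 1) * L) + M * E + M with hc₀
  have hc₀0 : 0 ≤ c₀ := by positivity
  set N := ‖kTwo V‖ with hN
  have hN0 : 0 ≤ N := norm_nonneg _
  set c₁ := 2 * N + c₀ with hc₁
  have hc₁0 : 0 ≤ c₁ := by positivity
  set r := min 1 (1 / (4 * c)) with hr
  have hr0 : 0 < r := lt_min one_pos (by positivity)
  -- half of the contraction condition `c (M ε + 2 r) ≤ 1`; small `ε` provides the other half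
  have hrc : c * (2 * r) ≤ 1 / 2 := by
    have h1 : r ≤ 1 / (4 * c) := min_le_right _ _
    calc c * (2 * r) ≤ c * (2 * (1 / (4 * c))) := by gcongr
      _ = 1 / 2 := by field_simp; norm_num
  set C := (c * (M + c₁) * c₁ + c₀) + E ^ 2 * (3 * c₁ + 2 * M * L) with hC
  refine ⟨a, b, M, u, u', r, C, hab, ha, hb, hK, hu, hr0, by positivity, ?_⟩
  have hsmall : ∀ s : ℝ, 0 < s → ∀ B : ℝ, ∀ᶠ ε in 𝓝[>] (0 : ℝ), B * ε ≤ s := fun s hs B => by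
    have h1 : Tendsto (fun ε : ℝ => B * ε) (𝓝[>] 0) (𝓝 0) := by
      have : Tendsto (fun ε : ℝ => B * ε) (𝓝 0) (𝓝 (B * 0)) := tendsto_id.const_mul B
      rw [mul_zero] at this
      exact this.mono_left nhdsWithin_le_nhds
    exact (h1.eventually (gt_mem_nhds hs)).mono fun ε h => h.le
  filter_upwards [self_mem_nhdsWithin, hsmall 1 one_pos 1, hsmall 1 one_pos M,
    hsmall (1 / 2) (by norm_num) (c * M), hsmall r hr0 c₁] with ε hε hε1 hMε hcM hc₁ε
  replace hε : 0 < ε := hε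
  rw [one_mul] at hε1
  obtain ⟨hQ, hQb, hQsq⟩ := hbounds ε hε hε1
  set Q : ℝ → ℂ := fun x => ∫ t in a..x, V t (t / ε) with hQdef
  have hQd : ∀ x, HasDerivAt Q (V x (x / ε)) x := fun x =>
    ((hV.continuous_comp ε).integral_hasStrictDerivAt a x).hasDerivAt
  have hQa : Q a = 0 := intervalIntegral.integral_same
  have hη0 : 0 ≤ M * ε := by positivity
  have hε32 : ε ^ 3 ≤ ε ^ 2 := pow_le_pow_of_le_one hε.le hε1 (by norm_num)
  have hε21 : ε ^ 2 ≤ ε := by nlinarith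
  have hD0 : ‖(u' ε 0 b + 0 * u ε 0 b) + 2 * kTwo V * ε ^ 2‖ ≤ c₀ * ε ^ 3 := by
    have h1 := (hu ε 0).norm_boundary_zero_le hab.le hQd hQa hQ hη0 hMε
    have h2 : (u' ε 0 b + 0 * u ε 0 b) + 2 * kTwo V * ε ^ 2 =
        (u' ε 0 b + ∫ x in a..b, Q x ^ 2) -
          ((∫ x in a..b, Q x ^ 2) - 2 * kTwo V * ε ^ 2) := by ring
    rw [h2]
    refine (norm_sub_le _ _).trans ((add_le_add h1 hQsq).trans ?_)
    have h3 : ‖Q b‖ * E ≤ M * ε ^ 3 * E := by gcongr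
    rw [← hE]
    calc _ ≤ (M * ε) ^ 3 * (E ^ 2 * (2 * L + 1) * L) + M * ε ^ 3 * E + M * ε ^ 3 := by gcongr
      _ = c₀ * ε ^ 3 := by rw [hc₀]; ring
  have hκ : ‖2 * kTwo V * (ε : ℂ) ^ 2‖ = 2 * N * ε ^ 2 := by
    simp [abs_of_pos hε, hN]
  have hκρ : ‖2 * kTwo V * (ε : ℂ) ^ 2‖ + c₀ * ε ^ 3 ≤ c₁ * ε ^ 2 := by
    rw [hκ, hc₁]
    linarith [mul_le_mul_of_nonneg_left hε32 hc₀0]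
  obtain ⟨k, hkr, hk0, huniq, hk1, hk2⟩ := existsUnique_zero_of_lipschitz
    (D := fun k => u' ε k b + k * u ε k b) (κ := 2 * kTwo V * ε ^ 2) (C := c) (ε := M * ε) (r := r)
    (ρ := c₀ * ε ^ 3) hc0.le hr0.le (by linarith) hD0
    (hκρ.trans ((mul_le_mul_of_nonneg_left hε21 hc₁0).trans hc₁ε))
    (fun k l hk hl => (hu ε k).norm_boundary_sub_le (hu ε l) (hu ε 0) hab.le hQd hQa hQ hη0 hMε
      (hk.trans (min_le_left _ _)) (hl.trans (min_le_left _ _)))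
  have hkε : ‖k‖ ≤ c₁ * ε ^ 2 := hk1.trans hκρ
  have hkε1 : ‖k‖ ≤ c₁ * ε := hkε.trans (mul_le_mul_of_nonneg_left hε21 hc₁0)
  refine ⟨k, hk0, huniq, ?_, fun x hx => ?_⟩
  · have h1 : k - ε ^ 2 * kTwo V = k - 2 * kTwo V * ε ^ 2 / 2 := by ring
    rw [h1]
    calc _ ≤ c * (M * ε + ‖k‖) * ‖k‖ + c₀ * ε ^ 3 := hk2
      _ ≤ c * (M * ε + c₁ * ε) * (c₁ * ε ^ 2) + c₀ * ε ^ 3 := by gcongr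
      _ = (c * (M + c₁) * c₁ + c₀) * ε ^ 3 := by ring
      _ ≤ C * ε ^ 3 := by
        refine mul_le_mul_of_nonneg_right ?_ (by positivity)
        rw [hC]
        have : 0 ≤ E ^ 2 * (3 * c₁ + 2 * M * L) := by positivity
        linarith
  · calc _ ≤ E ^ 2 * (3 * ‖k‖ + 2 * (M * ε) * L) :=
          (hu ε k).norm_sub_one_le (hu ε 0) hQd hQa hQ hη0 hMε (hkr.trans (min_le_left _ _)) x hx
      _ ≤ E ^ 2 * (3 * (c₁ * ε) + 2 * (M * ε) * L) := by gcongr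
      _ = (E ^ 2 * (3 * c₁ + 2 * M * L)) * ε := by ring
      _ ≤ C * ε := by
        refine mul_le_mul_of_nonneg_right ?_ hε.le
        rw [hC]
        have : 0 ≤ c * (M + c₁) * c₁ + c₀ := by positivity
        linarith

/-- For small `k` the tails, of size `1/(2k)` each, dominate the integral of `u²`. -/
theorem IsLeftSolution.integral_sq_ne_zero {q : ℝ → ℂ} {a b : ℝ} {k : ℂ} {u u' : ℝ → ℂ}
    (h : IsLeftSolution q a k u u') (hab : a ≤ b) (ha : ∀ x, x ≤ a → q x = 0)
    (hb : ∀ x, b ≤ x → q x = 0) (hk : 0 < k.re) (hD : u' b + k * u b = 0)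
    (hu1 : ∀ x ∈ Set.Icc a b, ‖u x - 1‖ ≤ 1 / 4) (hsmall : 8 * (b - a) * ‖k‖ ≤ 1) :
    ∫ x, u x ^ 2 ≠ 0 := by
  rw [(h.integral_sq hab ha hb hk hD).2]
  intro h0
  have hk0 : k ≠ 0 := fun h => by simp [h] at hk
  have hbm : b ∈ Set.Icc a b := Set.right_mem_Icc.2 hab
  have hle : ∀ x ∈ Set.Icc a b, ‖u x‖ ≤ 5 / 4 := fun x hx => by
    have := norm_add_le (u x - 1) 1
    rw [sub_add_cancel, norm_one] at this
    linarith [hu1 x hx]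
  have h1 : ‖∫ x in a..b, u x ^ 2‖ ≤ 4 * (b - a) := by
    refine norm_intervalIntegral_le_of_mem_Icc hbm (by norm_num) fun x hx => ?_
    rw [norm_pow]
    nlinarith [hle x hx, norm_nonneg (u x)]
  have h2 : (2 : ℂ) = -(2 * k * ∫ x in a..b, u x ^ 2) - (u b - 1) * (u b + 1) := by
    field_simp at h0
    linear_combination h0
  have h3 : ‖(2 : ℂ)‖ ≤ 1 + 1 / 4 * (5 / 4 + 1) := by
    rw [h2]
    refine (_root_.norm_sub_le _ _).trans (add_le_add ?_ ?_)
    · rw [norm_neg, norm_mul, norm_mul, Complex.norm_ofNat]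
      calc 2 * ‖k‖ * ‖∫ x in a..b, u x ^ 2‖ ≤ 2 * ‖k‖ * (4 * (b - a)) := by gcongr
        _ = 8 * (b - a) * ‖k‖ := by ring
        _ ≤ 1 := hsmall
    · rw [norm_mul]
      gcongr
      · exact hu1 b hbm
      · refine (norm_add_le _ _).trans ?_
        rw [norm_one]
        linarith [hle b hbm]
  rw [Complex.norm_ofNat] at h3
  norm_num at h3

theorem theorem1 (V : ℝ → ℝ → ℂ) (hV : IsOscillatingPotential V)
    (hmean : ∀ x : ℝ, ∫ ξ in (0 : ℝ)..1, V x ξ = 0) :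
    (0 < (kTwo V).re →
      ∃ lam : ℝ → ℂ,
        Tendsto lam (𝓝[>] 0) (𝓝 0) ∧
        (∀ᶠ ε in 𝓝[>] (0 : ℝ), IsSimpleEigenvalue (schrodingerOp hV ε) (lam ε)) ∧
        (∃ δ > 0, ∀ᶠ ε in 𝓝[>] (0 : ℝ), ∀ μ : ℂ, ‖μ‖ < δ →
          IsEigenvalue (schrodingerOp hV ε) μ → μ = lam ε) ∧
        (fun ε : ℝ => lam ε - (-((ε : ℂ) ^ 4 * kTwo V ^ 2))) =O[𝓝[>] 0] fun ε : ℝ => ε ^ 5) ∧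
    ((kTwo V).re < 0 →
      ∃ δ > 0, ∀ᶠ ε in 𝓝[>] (0 : ℝ), ∀ μ : ℂ, ‖μ‖ < δ →
        ¬ IsEigenvalue (schrodingerOp hV ε) μ) := by
  obtain ⟨a, b, K, u, u', r, C, hab, ha, hb, hK, hu, hr0, hC0, hev⟩ :=
    hV.exists_boundary_zero hmean
  obtain ⟨k, hk⟩ := hev.choice
  have hL0 : 0 < b - a := sub_pos.2 hab
  -- every small eigenvalue is `-k(ε)²`, and it exists only if `0 < Re k(ε)`
  have huniq : ∀ᶠ ε in 𝓝[>] (0 : ℝ), ∀ μ : ℂ, ‖μ‖ < r ^ 2 →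
      IsEigenvalue (schrodingerOp hV ε) μ → 0 < (k ε).re ∧ μ = -k ε ^ 2 := by
    filter_upwards [hk] with ε hε μ hμ hμe
    obtain ⟨l, hl, hlre⟩ := Complex.exists_sq_eq_re_nonneg (-μ)
    obtain rfl : μ = -l ^ 2 := by rw [hl, neg_neg]
    have hlr : ‖l‖ ≤ r := by
      rw [norm_neg, norm_pow] at hμ
      exact (lt_of_pow_lt_pow_left₀ 2 hr0.le hμ).le
    obtain ⟨h1, h2⟩ := boundary_eq_zero_of_isEigenvalue hV ha hb hK hlre (hu ε l) hμe
    rw [← hε.2.1 l hlr h2]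
    exact ⟨h1, rfl⟩
  have hre : ∀ᶠ ε in 𝓝[>] (0 : ℝ), |(k ε).re - ε ^ 2 * (kTwo V).re| ≤ C * ε ^ 3 := by
    filter_upwards [hk] with ε hε
    have h1 := (Complex.abs_re_le_norm _).trans hε.2.2.1
    have h2 : (k ε - (ε : ℂ) ^ 2 * kTwo V).re = (k ε).re - ε ^ 2 * (kTwo V).re := by
      rw [Complex.sub_re, ← Complex.ofReal_pow, Complex.re_ofReal_mul]
    rwa [h2] at h1
  have hsmall : ∀ s : ℝ, 0 < s → ∀ B : ℝ, ∀ᶠ ε in 𝓝[>] (0 : ℝ), B * ε < s := fun s hs B => by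
    have h1 : Tendsto (fun ε : ℝ => B * ε) (𝓝[>] 0) (𝓝 0) := by
      have : Tendsto (fun ε : ℝ => B * ε) (𝓝 0) (𝓝 (B * 0)) := tendsto_id.const_mul B
      rw [mul_zero] at this
      exact this.mono_left nhdsWithin_le_nhds
    exact h1.eventually (gt_mem_nhds hs)
  have hpos : ∀ᶠ ε in 𝓝[>] (0 : ℝ), 0 < ε := self_mem_nhdsWithin
  refine ⟨fun hk2 => ?_, fun hk2 => ⟨r ^ 2, by positivity, ?_⟩⟩
  · set N := ‖kTwo V‖ with hN
    have hN0 : 0 ≤ N := norm_nonneg _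
    have hnorm : ∀ᶠ ε in 𝓝[>] (0 : ℝ), ‖k ε‖ ≤ (N + C) * ε ^ 2 := by
      filter_upwards [hk, hpos, hsmall 1 one_pos 1] with ε hε h0 h1
      have h2 := norm_add_le (k ε - ε ^ 2 * kTwo V) (ε ^ 2 * kTwo V)
      rw [sub_add_cancel, norm_mul, norm_pow, Complex.norm_real, Real.norm_of_nonneg h0.le,
        ← hN] at h2
      have h3 : C * ε ^ 3 ≤ C * ε ^ 2 := by
        gcongr ?_ * ?_
        exact pow_le_pow_of_le_one h0.le (by linarith) (by norm_num)
      linarith [hε.2.2.1]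
    have hO : (fun ε : ℝ => -k ε ^ 2 - (-((ε : ℂ) ^ 4 * kTwo V ^ 2))) =O[𝓝[>] 0]
        fun ε : ℝ => ε ^ 5 := by
      refine IsBigO.of_bound (C * (N + C + N)) ?_
      filter_upwards [hk, hpos, hnorm] with ε hε h0 h1
      have e1 : -k ε ^ 2 - (-((ε : ℂ) ^ 4 * kTwo V ^ 2)) =
          -((k ε - ε ^ 2 * kTwo V) * (k ε + ε ^ 2 * kTwo V)) := by ring
      rw [e1, norm_neg, norm_mul, Real.norm_of_nonneg (by positivity)]
      have e2 : ‖k ε + ε ^ 2 * kTwo V‖ ≤ (N + C + N) * ε ^ 2 := by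
        refine (norm_add_le _ _).trans ?_
        rw [norm_mul, norm_pow, Complex.norm_real, Real.norm_of_nonneg h0.le, ← hN]
        linarith
      calc _ ≤ C * ε ^ 3 * ((N + C + N) * ε ^ 2) := by
            gcongr
            exact hε.2.2.1
        _ = _ := by ring
    have hkre : ∀ᶠ ε in 𝓝[>] (0 : ℝ), 0 < (k ε).re := by
      filter_upwards [hre, hpos, hsmall _ hk2 C] with ε h1 h0 h2
      have h3 : C * ε ^ 3 < ε ^ 2 * (kTwo V).re := by
        calc C * ε ^ 3 = ε ^ 2 * (C * ε) := by ring
          _ < _ := by gcongr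
      linarith [(abs_le.1 h1).1]
    refine ⟨fun ε => -k ε ^ 2, ?_, ?_, ⟨r ^ 2, by positivity, ?_⟩, hO⟩
    · have h5 : Tendsto (fun ε : ℝ => ε ^ 5) (𝓝[>] 0) (𝓝 0) := by
        have : Tendsto (fun ε : ℝ => ε ^ 5) (𝓝 0) (𝓝 (0 ^ 5)) := (continuous_pow 5).tendsto 0
        rw [zero_pow (by norm_num)] at this
        exact this.mono_left nhdsWithin_le_nhds
      have h4 : Tendsto (fun ε : ℝ => -((ε : ℂ) ^ 4 * kTwo V ^ 2)) (𝓝[>] 0) (𝓝 0) := by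
        have hc : Continuous fun ε : ℝ => -((ε : ℂ) ^ 4 * kTwo V ^ 2) := by fun_prop
        have := hc.tendsto 0
        simp only [Complex.ofReal_zero, ne_eq, OfNat.ofNat_ne_zero, not_false_eq_true, zero_pow,
          zero_mul, neg_zero] at this
        exact this.mono_left nhdsWithin_le_nhds
      simpa using (hO.trans_tendsto h5).add h4
    · filter_upwards [hk, hpos, hkre, hnorm, hsmall (1 / 4) (by norm_num) C,
        hsmall 1 one_pos 1, hsmall 1 one_pos (8 * (b - a) * (N + C))] with ε hε h0 h1 h2 h3 h4 h5
      refine isSimpleEigenvalue_of_boundary_eq_zero hV hab.le ha hb hK h1 (hu ε (k ε)) hε.1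
        ((hu ε (k ε)).integral_sq_ne_zero hab.le (fun x hx => ha x _ hx) (fun x hx => hb x _ hx)
          h1 hε.1 (fun x hx => (hε.2.2.2 x hx).trans h3.le) ?_)
      have h6 : ε ^ 2 ≤ ε := by nlinarith
      calc 8 * (b - a) * ‖k ε‖ ≤ 8 * (b - a) * ((N + C) * ε) := by
            gcongr
            exact h2.trans (by gcongr)
        _ ≤ 1 := by linarith
    · filter_upwards [huniq] with ε hε μ hμ hμe
      exact (hε μ hμ hμe).2
  · filter_upwards [huniq, hre, hpos, hsmall (-(kTwo V).re) (by linarith) C] with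
      ε hε h1 h0 h2 μ hμ hμe
    have h3 : C * ε ^ 3 < ε ^ 2 * -(kTwo V).re := by
      calc C * ε ^ 3 = ε ^ 2 * (C * ε) := by ring
        _ < _ := by gcongr
    linarith [(abs_le.1 h1).2, (hε μ hμ hμe).1]
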